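/- Let $n\ge 3$, let $M$ be a closed (compact, without boundary) smooth $n$-manifold, and let $g$ be a $C^2$ Riemannian metric on $M$. For each $i\in\mathbb N$ let $u_i:M\to(0,\infty)$ be a positive $C^2$ function, and put $g_i=u_i\,g$. Suppose that $g_i\to g$ on $M$ in the $W^{1,\infty}$-sense as $i\to\infty$, that is, $$\big\|\,|g_i-g|_g\,\big\|_{L^\infty(M,\,d\mathrm{vol}_g)}+\big\|\,|\nabla_g(g_i-g)|_g\,\big\|_{L^\infty(M,\,d\mathrm{vol}_g)}\longrightarrow 0 ,$$ where $\nabla_g$ is the Levi-Civita connection of $g$ and $|\cdot|_g$ is the pointwise norm on tensors induced by $g$. Let $\kappa\in\mathbb R$ be a constant such that $$\int_M R(g_i)\,d\mathrm{vol}_{g_i}\ \ge\ \kappa\qquad\text{for all } i ,$$ where $R(\cdot)$ denotes the scalar curvature and $d\mathrm{vol}$ the Riemannian volume measure; no sign condition on the scalar curvatures $R(g_i)$ is assumed. Then $$\int_M R(g)\,d\mathrm{vol}_g\ \ge\ \kappa .$$ -/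

import Mathlib

open Filter Topology MeasureTheory
open scoped Manifold ContDiff ENNReal Matrix

noncomputable section

namespace TotalScalar

/-! ### Tensor calculus in local coordinates

In this section `G z` is the matrix `(g_ij(z))` of a metric in coordinates `z` of an open subset of
`ℝⁿ`, and `H z` is the matrix `(h_ij(z))` of another `(0,2)`-tensor. -/

section Local

variable {n : ℕ}

/-- The coordinate derivative `∂_k f (z)`. -/
def partialDeriv (k : Fin n) (f : EuclideanSpace ℝ (Fin n) → ℝ) (z : EuclideanSpace ℝ (Fin n)) :
    ℝ :=
  fderiv ℝ f z (EuclideanSpace.single k 1)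

/-- The Christoffel symbols
`Γ^l_ij = 1/2 ∑_m g^{lm} (∂_i g_jm + ∂_j g_im - ∂_m g_ij)`. -/
def christoffel (G : EuclideanSpace ℝ (Fin n) → Matrix (Fin n) (Fin n) ℝ) (l i j : Fin n)
    (z : EuclideanSpace ℝ (Fin n)) : ℝ :=
  (1 / 2 : ℝ) * ∑ m, (G z)⁻¹ l m *
    (partialDeriv i (fun w => G w j m) z + partialDeriv j (fun w => G w i m) z
      - partialDeriv m (fun w => G w i j) z)

/-- The coefficients of the Riemann curvature tensor: `R(∂_i, ∂_j) ∂_k = ∑_l R^l_kij ∂_l` with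
`R^l_kij = ∂_i Γ^l_jk - ∂_j Γ^l_ik + ∑_m (Γ^l_im Γ^m_jk - Γ^l_jm Γ^m_ik)`. -/
def riemannCoeff (G : EuclideanSpace ℝ (Fin n) → Matrix (Fin n) (Fin n) ℝ) (l k i j : Fin n)
    (z : EuclideanSpace ℝ (Fin n)) : ℝ :=
  partialDeriv i (christoffel G l j k) z - partialDeriv j (christoffel G l i k) z
    + ∑ m, (christoffel G l i m z * christoffel G m j k z
      - christoffel G l j m z * christoffel G m i k z)

/-- The Ricci tensor `R_jk = ∑_i R^i_kij`. -/
def ricciCoeff (G : EuclideanSpace ℝ (Fin n) → Matrix (Fin n) (Fin n) ℝ) (j k : Fin n)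
    (z : EuclideanSpace ℝ (Fin n)) : ℝ :=
  ∑ i, riemannCoeff G i k i j z

/-- The scalar curvature `∑_jk g^{jk} R_jk`; it is `n (n - 1)` for the unit sphere. -/
def localScalarCurvature (G : EuclideanSpace ℝ (Fin n) → Matrix (Fin n) (Fin n) ℝ)
    (z : EuclideanSpace ℝ (Fin n)) : ℝ :=
  ∑ j, ∑ k, (G z)⁻¹ j k * ricciCoeff G j k z

/-- The covariant derivative, for the Levi-Civita connection of `G`, of the `(0,2)`-tensor `H`:
`∇_k h_ij = ∂_k h_ij - ∑_l (Γ^l_ki h_lj + Γ^l_kj h_il)`. -/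
def covDerivCoeff (G H : EuclideanSpace ℝ (Fin n) → Matrix (Fin n) (Fin n) ℝ) (k i j : Fin n)
    (z : EuclideanSpace ℝ (Fin n)) : ℝ :=
  partialDeriv k (fun w => H w i j) z
    - ∑ l, (christoffel G l k i z * H z l j + christoffel G l k j z * H z i l)

/-- `|h|² = ∑ g^{ia} g^{jb} h_ij h_ab`. -/
def localTensorNormSq (G H : EuclideanSpace ℝ (Fin n) → Matrix (Fin n) (Fin n) ℝ)
    (z : EuclideanSpace ℝ (Fin n)) : ℝ :=
  ∑ i, ∑ j, ∑ a, ∑ b, (G z)⁻¹ i a * (G z)⁻¹ j b * H z i j * H z a b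

/-- `|∇h|² = ∑ g^{kc} g^{ia} g^{jb} (∇_k h_ij) (∇_c h_ab)`. -/
def localCovDerivNormSq (G H : EuclideanSpace ℝ (Fin n) → Matrix (Fin n) (Fin n) ℝ)
    (z : EuclideanSpace ℝ (Fin n)) : ℝ :=
  ∑ k, ∑ i, ∑ j, ∑ c, ∑ a, ∑ b, (G z)⁻¹ k c * (G z)⁻¹ i a * (G z)⁻¹ j b
    * covDerivCoeff G H k i j z * covDerivCoeff G H c a b z

end Local

/-! ### Riemannian metrics on a smooth manifold -/

section Global

variable {n : ℕ} {M : Type*} [TopologicalSpace M] [ChartedSpace (EuclideanSpace ℝ (Fin n)) M]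

/-- A field of bilinear forms on the tangent spaces, i.e. a (rough) `(0,2)`-tensor field. -/
abbrev BilinField (n : ℕ) (M : Type*) [TopologicalSpace M]
    [ChartedSpace (EuclideanSpace ℝ (Fin n)) M] : Type _ :=
  ∀ x : M, TangentSpace (𝓡 n) x →L[ℝ] TangentSpace (𝓡 n) x →L[ℝ] ℝ

/-- The standard basis vector `e_i`, as a tangent vector of `ℝⁿ` at `z`. -/
def stdVec (z : EuclideanSpace ℝ (Fin n)) (i : Fin n) : TangentSpace (𝓡 n) z :=
  (EuclideanSpace.single i (1 : ℝ) : EuclideanSpace ℝ (Fin n))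

/-- The coordinate vector `∂_i = d(φ⁻¹)_z e_i` at `φ⁻¹(z)`, for the preferred chart `φ` at `x`;
meaningful for `z` in the (open) image of the chart. -/
def coordVec (x : M) (z : EuclideanSpace ℝ (Fin n)) (i : Fin n) :
    TangentSpace (𝓡 n) ((extChartAt (𝓡 n) x).symm z) :=
  mfderiv (𝓡 n) (𝓡 n) (extChartAt (𝓡 n) x).symm z (stdVec z i)

/-- The matrix `h_ij(z) = h(∂_i, ∂_j)` of a `(0,2)`-tensor field in the preferred chart at `x`. -/
def coordMatrix (h : BilinField n M) (x : M) (z : EuclideanSpace ℝ (Fin n)) :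
    Matrix (Fin n) (Fin n) ℝ :=
  Matrix.of fun i j => h ((extChartAt (𝓡 n) x).symm z) (coordVec x z i) (coordVec x z j)

section Metric

variable [IsManifold (𝓡 n) ∞ M]

/-- `C²` Riemannian metrics on the smooth `n`-manifold `M`. -/
abbrev C2Metric (n : ℕ) (M : Type*) [TopologicalSpace M]
    [ChartedSpace (EuclideanSpace ℝ (Fin n)) M] [IsManifold (𝓡 n) ∞ M] : Type _ :=
  Bundle.ContMDiffRiemannianMetric (𝓡 n) 2 (EuclideanSpace ℝ (Fin n))
    (fun x : M => TangentSpace (𝓡 n) x)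

/-- The scalar curvature `R(g)` at `x`, computed in the preferred chart at `x`. -/
def scalarCurvature (g : C2Metric n M) (x : M) : ℝ :=
  localScalarCurvature (coordMatrix g.inner x) (extChartAt (𝓡 n) x x)

/-- The pointwise norm `|h|_g` of a `(0,2)`-tensor field. -/
def tensorNorm (g : C2Metric n M) (h : BilinField n M) (x : M) : ℝ :=
  Real.sqrt (localTensorNormSq (coordMatrix g.inner x) (coordMatrix h x) (extChartAt (𝓡 n) x x))

/-- The pointwise norm `|∇_g h|_g` of the Levi-Civita covariant derivative of a `(0,2)`-tensor
field (of class `C¹`). -/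
def covDerivNorm (g : C2Metric n M) (h : BilinField n M) (x : M) : ℝ :=
  Real.sqrt
    (localCovDerivNormSq (coordMatrix g.inner x) (coordMatrix h x) (extChartAt (𝓡 n) x x))

/-- A smooth partition of unity subordinate to the sources of the preferred charts. -/
def chartPartition (n : ℕ) (M : Type*) [TopologicalSpace M]
    [ChartedSpace (EuclideanSpace ℝ (Fin n)) M] [IsManifold (𝓡 n) ∞ M]
    [CompactSpace M] [T2Space M] : SmoothPartitionOfUnity M (𝓡 n) M Set.univ :=
  Classical.choose (SmoothPartitionOfUnity.exists_isSubordinate_chartAt_source (𝓡 n) M)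

variable [MeasurableSpace M]

/-- The Riemannian volume measure on the domain of the preferred chart at `c`: the image of
`√(det (g_ij)) dz` under the inverse of the chart. -/
def chartVolume (g : C2Metric n M) (c : M) : Measure M :=
  (((volume : Measure (EuclideanSpace ℝ (Fin n))).restrict (extChartAt (𝓡 n) c).target).withDensity
    (fun z => ENNReal.ofReal (Real.sqrt (coordMatrix g.inner c z).det))).map
      (extChartAt (𝓡 n) c).symm

variable [CompactSpace M] [T2Space M]

/-- The Riemannian volume measure `dvol_g = ∑_c ρ_c dvol_{g, c}`, glued from the volume measures of
chart domains by means of a partition of unity (by the change of variables formula, the result does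
not depend on the charts nor on the partition). -/
def volumeMeasure (g : C2Metric n M) : Measure M :=
  Measure.sum fun c : M =>
    (chartVolume g c).withDensity fun x => ENNReal.ofReal (chartPartition n M c x)

/-- The total scalar curvature `∫_M R(g) dvol_g`. -/
def totalScalarCurvature (g : C2Metric n M) : ℝ :=
  ∫ x, scalarCurvature g x ∂(volumeMeasure g)

/-- The `W^{1,p}(M, g)`-norm `‖ |h|_g ‖_{L^p} + ‖ |∇_g h|_g ‖_{L^p}` of a `(0,2)`-tensor field `h`
of class `C¹` (for which weak and classical covariant derivatives agree), `1 ≤ p ≤ ∞`. -/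
def sobolevNorm (p : ℝ≥0∞) (g : C2Metric n M) (h : BilinField n M) : ℝ≥0∞ :=
  eLpNorm (tensorNorm g h) p (volumeMeasure g) + eLpNorm (covDerivNorm g h) p (volumeMeasure g)

/-- `g_i → g` in the `W^{1,p}`-sense: `‖g_i - g‖_{W^{1,p}(M, g)} → 0`. -/
def SobolevConverges (p : ℝ≥0∞) (gs : ℕ → C2Metric n M) (g : C2Metric n M) : Prop :=
  Tendsto (fun i => sobolevNorm p g (fun x => (gs i).inner x - g.inner x)) atTop (𝓝 0)

end Metric

end Global

end TotalScalar

end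

noncomputable section

namespace TotalScalar

/-! ### Connections and curvature on a normed space -/

section Connection

variable {E : Type*} [NormedAddCommGroup E] [NormedSpace ℝ E]

/-! Write `u_i = exp φ_i`. The conformal formula gives `R(exp φ • g) = exp(-φ) (R(g) - (n-1) Δφ -
(n-1)(n-2)/4 |dφ|²)`, while the volume density is multiplied by `exp(n φ / 2)`. The total scalar
curvature therefore contains second derivatives of `φ` only through `exp((n/2 - 1) φ) Δφ dvol_g`.
Since `√det g · Δφ` is a divergence, integrating by parts leaves an expression in `φ` and `dφ`
alone. Because `|g_i - g|_g = √n |u_i - 1|` and `|∇(g_i - g)|_g = √n |du_i|`, convergence in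
`W^{1,∞}` makes `φ_i` and `dφ_i` tend to `0` uniformly almost everywhere. Dominated convergence then
shows that the total scalar curvatures actually converge to that of `g`, and the lower bound `κ`
passes to the limit.

The argument is localized by the partition of unity in the definition of the volume, which is the
same for all metrics; its derivatives enter the integration by parts but cause no harm. The scalar
curvature and the norms are defined in a chart that varies with the point, so they must first be
moved to a fixed chart. This is the role of `localScalarCurvature_transform` and
`localGradSq_transform`. The analytic core is `localScalarCurvature_conformal`,
`integral_scalarCurvature_conformal` and `tendsto_integral_scalarCurvature_conformal`. The link to
the Sobolev norm is `exists_chart_bound`. -/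

/-- The curvature operator `R(v, w) x` of the connection with Christoffel map `Γ`. -/
def curvOp (Γ : E → E →L[ℝ] E →L[ℝ] E) (z v w x : E) : E :=
  fderiv ℝ Γ z v w x - fderiv ℝ Γ z w v x + Γ z v (Γ z w x) - Γ z w (Γ z v x)

/-- The Koszul formula at the point `z`. -/
def IsLeviCivitaAt (B : E → E →L[ℝ] E →L[ℝ] ℝ) (Γ : E → E →L[ℝ] E →L[ℝ] E) (z : E) : Prop :=
  ∀ v w x, 2 * B z (Γ z v w) x = fderiv ℝ B z v w x + fderiv ℝ B z w v x - fderiv ℝ B z x v w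

lemma hasFDerivAt_apply₂ {F : Type*} [NormedAddCommGroup F] [NormedSpace ℝ F]
    {B : E → E →L[ℝ] E →L[ℝ] F} {f g : E → E} {f' g' : E →L[ℝ] E} {z : E}
    (hB : DifferentiableAt ℝ B z) (hf : HasFDerivAt f f' z) (hg : HasFDerivAt g g' z) (x : E) :
    fderiv ℝ (fun y => B y (f y) (g y)) z x
      = fderiv ℝ B z x (f z) (g z) + B z (f' x) (g z) + B z (f z) (g' x) := by
  have h := (hB.hasFDerivAt.clm_apply hf).clm_apply hg
  rw [h.fderiv]
  simp
  abel

lemma fderiv_apply₂ {F : Type*} [NormedAddCommGroup F] [NormedSpace ℝ F]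
    {B : E → E →L[ℝ] E →L[ℝ] F} {z : E} (hB : DifferentiableAt ℝ B z) (x v w : E) :
    fderiv ℝ (fun y => B y v w) z x = fderiv ℝ B z x v w := by
  simpa using hasFDerivAt_apply₂ hB (hasFDerivAt_const v z) (hasFDerivAt_const w z) x

lemma fderiv_symm {F : Type*} [NormedAddCommGroup F] [NormedSpace ℝ F]
    {B : E → E →L[ℝ] E →L[ℝ] F} {z : E} (hB : DifferentiableAt ℝ B z)
    (hsymm : ∀ᶠ y in 𝓝 z, ∀ v w, B y v w = B y w v) (x v w : E) :
    fderiv ℝ B z x v w = fderiv ℝ B z x w v := by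
  rw [← fderiv_apply₂ hB, ← fderiv_apply₂ hB]
  have : (fun y => B y v w) =ᶠ[𝓝 z] fun y => B y w v := by
    filter_upwards [hsymm] with y hy using hy v w
  rw [this.fderiv_eq]

/-- A Levi-Civita connection is compatible with the metric. -/
lemma IsLeviCivitaAt.fderiv_eq {B : E → E →L[ℝ] E →L[ℝ] ℝ} {Γ : E → E →L[ℝ] E →L[ℝ] E} {z : E}
    (h : IsLeviCivitaAt B Γ z) (hB : DifferentiableAt ℝ B z)
    (hsymm : ∀ y v w, B y v w = B y w v) (x v w : E) :
    fderiv ℝ B z x v w = B z (Γ z x v) w + B z v (Γ z x w) := by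
  -- Adding these two Koszul formulas cancels everything except twice the derivative in the
  -- direction `x`.
  have h1 := h x v w
  have h2 := h x w v
  have s := fderiv_symm hB (.of_forall hsymm)
  rw [hsymm z v]
  have := s x w v
  have := s v w x
  have := s w v x
  have := s w x v
  linarith [s v x w]

/-- A Levi-Civita connection is torsion free. -/
lemma IsLeviCivitaAt.torsionFree {B : E → E →L[ℝ] E →L[ℝ] ℝ} {Γ : E → E →L[ℝ] E →L[ℝ] E} {z : E}
    (h : IsLeviCivitaAt B Γ z) (hB : DifferentiableAt ℝ B z)
    (hsymm : ∀ y v w, B y v w = B y w v) (hnd : ∀ v, (∀ w, B z v w = 0) → v = 0) (v w : E) :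
    Γ z v w = Γ z w v := by
  rw [← sub_eq_zero]
  apply hnd
  intro x
  have h1 := h v w x
  have h2 := h w v x
  have s := fderiv_symm hB (.of_forall hsymm) x v w
  simp only [map_sub, sub_apply]
  linarith

/-- The transformation law of the Christoffel symbols under a change of coordinates `τ`. -/
lemma IsLeviCivitaAt.transform {B B' : E → E →L[ℝ] E →L[ℝ] ℝ} {Γ Γ' : E → E →L[ℝ] E →L[ℝ] E}
    {τ : E → E} {z : E} (h' : IsLeviCivitaAt B' Γ' z) (h : IsLeviCivitaAt B Γ (τ z))
    (hB : DifferentiableAt ℝ B (τ z)) (hB' : DifferentiableAt ℝ B' z)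
    (hsymm : ∀ y v w, B y v w = B y w v)
    (hnd : ∀ v, (∀ w, B (τ z) v w = 0) → v = 0) (hτ : ContDiffAt ℝ 2 τ z)
    (hsurj : Function.Surjective (fderiv ℝ τ z))
    (hpull : ∀ᶠ y in 𝓝 z, ∀ v w, B' y v w = B (τ y) (fderiv ℝ τ y v) (fderiv ℝ τ y w)) (v w : E) :
    fderiv ℝ τ z (Γ' z v w)
      = Γ (τ z) (fderiv ℝ τ z v) (fderiv ℝ τ z w) + fderiv ℝ (fderiv ℝ τ) z v w := by
  have hτd : DifferentiableAt ℝ τ z := hτ.differentiableAt (by norm_num)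
  have hJ : DifferentiableAt ℝ (fderiv ℝ τ) z :=
    (hτ.fderiv_right (m := 1) (by norm_num)).differentiableAt (by norm_num)
  have hJv (v : E) : HasFDerivAt (fun y => fderiv ℝ τ y v)
      ((ContinuousLinearMap.apply ℝ E v).comp (fderiv ℝ (fderiv ℝ τ) z)) z :=
    (ContinuousLinearMap.apply ℝ E v).hasFDerivAt.comp z hJ.hasFDerivAt
  have hBτ : DifferentiableAt ℝ (fun y => B (τ y)) z :=
    DifferentiableAt.comp (g := B) z hB hτd
  have hBτ' (x : E) : fderiv ℝ (fun y => B (τ y)) z x = fderiv ℝ B (τ z) (fderiv ℝ τ z x) := by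
    have := (HasFDerivAt.comp (g := B) z hB.hasFDerivAt hτd.hasFDerivAt).fderiv
    rw [show (fun y => B (τ y)) = B ∘ τ from rfl, this]
    rfl
  -- Product rule for the pullback: besides the derivative of `B`, each slot contributes a second
  -- derivative of `τ`.
  have key (x v w : E) : fderiv ℝ B' z x v w
      = fderiv ℝ B (τ z) (fderiv ℝ τ z x) (fderiv ℝ τ z v) (fderiv ℝ τ z w)
        + B (τ z) (fderiv ℝ (fderiv ℝ τ) z x v) (fderiv ℝ τ z w)
        + B (τ z) (fderiv ℝ τ z v) (fderiv ℝ (fderiv ℝ τ) z x w) := by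
    rw [← fderiv_apply₂ hB']
    have : (fun y => B' y v w) =ᶠ[𝓝 z]
        fun y => B (τ y) (fderiv ℝ τ y v) (fderiv ℝ τ y w) := by
      filter_upwards [hpull] with y hy using hy v w
    rw [this.fderiv_eq, hasFDerivAt_apply₂ hBτ (hJv v) (hJv w), hBτ']
    simp
  have hs : ∀ a b, fderiv ℝ (fderiv ℝ τ) z a b = fderiv ℝ (fderiv ℝ τ) z b a :=
    hτ.isSymmSndFDerivAt (by simp)
  rw [← sub_eq_zero]
  apply hnd
  intro y
  -- Test vectors may be taken in the image of `Dτ`. In the Koszul combination six terms contain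
  -- `D²τ`; by symmetry of `D²τ` four cancel and the other two are equal.
  obtain ⟨x, rfl⟩ := hsurj y
  have h1 := h' v w x
  have h2 := h (fderiv ℝ τ z v) (fderiv ℝ τ z w) (fderiv ℝ τ z x)
  rw [hpull.self_of_nhds, key, key, key, hs w v, hs x v, hs x w,
    hsymm (τ z) (fderiv ℝ τ z w) (fderiv ℝ (fderiv ℝ τ) z v x)] at h1
  simp only [map_sub, map_add, sub_apply, add_apply]
  linarith

/-- Tensoriality of the curvature operator under a change of coordinates `τ`. -/
lemma curvOp_transform {Γ Γ' : E → E →L[ℝ] E →L[ℝ] E} {τ : E → E} {z : E}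
    (hτ : ContDiffAt ℝ 3 τ z) (hΓ : DifferentiableAt ℝ Γ (τ z)) (hΓ' : DifferentiableAt ℝ Γ' z)
    (hlaw : ∀ᶠ y in 𝓝 z, ∀ v w, fderiv ℝ τ y (Γ' y v w)
      = Γ (τ y) (fderiv ℝ τ y v) (fderiv ℝ τ y w) + fderiv ℝ (fderiv ℝ τ) y v w) (v w x : E) :
    fderiv ℝ τ z (curvOp Γ' z v w x)
      = curvOp Γ (τ z) (fderiv ℝ τ z v) (fderiv ℝ τ z w) (fderiv ℝ τ z x) := by
  have hτd : DifferentiableAt ℝ τ z := hτ.differentiableAt (by norm_num)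
  have hJc : ContDiffAt ℝ 2 (fderiv ℝ τ) z := hτ.fderiv_right (m := 2) (by norm_num)
  have hJ : DifferentiableAt ℝ (fderiv ℝ τ) z := hJc.differentiableAt (by norm_num)
  have hH : DifferentiableAt ℝ (fderiv ℝ (fderiv ℝ τ)) z :=
    (hJc.fderiv_right (m := 1) (by norm_num)).differentiableAt (by norm_num)
  have hJv (v : E) : HasFDerivAt (fun y => fderiv ℝ τ y v)
      ((ContinuousLinearMap.apply ℝ E v).comp (fderiv ℝ (fderiv ℝ τ) z)) z :=
    (ContinuousLinearMap.apply ℝ E v).hasFDerivAt.comp z hJ.hasFDerivAt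
  have hΓτ : DifferentiableAt ℝ (fun y => Γ (τ y)) z :=
    DifferentiableAt.comp (g := Γ) z hΓ hτd
  have hΓτ' (x : E) : fderiv ℝ (fun y => Γ (τ y)) z x = fderiv ℝ Γ (τ z) (fderiv ℝ τ z x) := by
    have := (HasFDerivAt.comp (g := Γ) z hΓ.hasFDerivAt hτd.hasFDerivAt).fderiv
    rw [show (fun y => Γ (τ y)) = Γ ∘ τ from rfl, this]
    rfl
  -- This is the Christoffel transformation law differentiated in the direction `y`.
  have key (y v w : E) : fderiv ℝ (fderiv ℝ τ) z y (Γ' z v w) + fderiv ℝ τ z (fderiv ℝ Γ' z y v w)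
      = fderiv ℝ Γ (τ z) (fderiv ℝ τ z y) (fderiv ℝ τ z v) (fderiv ℝ τ z w)
        + Γ (τ z) (fderiv ℝ (fderiv ℝ τ) z y v) (fderiv ℝ τ z w)
        + Γ (τ z) (fderiv ℝ τ z v) (fderiv ℝ (fderiv ℝ τ) z y w)
        + fderiv ℝ (fderiv ℝ (fderiv ℝ τ)) z y v w := by
    have e : (fun y => fderiv ℝ τ y (Γ' y v w)) =ᶠ[𝓝 z] fun y =>
        Γ (τ y) (fderiv ℝ τ y v) (fderiv ℝ τ y w) + fderiv ℝ (fderiv ℝ τ) y v w := by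
      filter_upwards [hlaw] with y hy using hy v w
    have e' := congrArg (fun L => L y) (e.fderiv_eq (𝕜 := ℝ))
    have d1 : DifferentiableAt ℝ (fun y => Γ (τ y) (fderiv ℝ τ y v) (fderiv ℝ τ y w)) z :=
      (hΓτ.clm_apply (hJv v).differentiableAt).clm_apply (hJv w).differentiableAt
    have d2 : DifferentiableAt ℝ (fun y => fderiv ℝ (fderiv ℝ τ) y v w) z := by fun_prop
    have d3 : DifferentiableAt ℝ (fun y => Γ' y v w) z := by fun_prop
    rw [fderiv_fun_add d1 d2, add_apply, fderiv_apply₂ hH,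
      hasFDerivAt_apply₂ hΓτ (hJv v) (hJv w), hΓτ',
      (hJ.hasFDerivAt.clm_apply d3.hasFDerivAt).fderiv] at e'
    simp only [add_apply, ContinuousLinearMap.comp_apply,
      ContinuousLinearMap.flip_apply, fderiv_apply₂ hΓ'] at e'
    simpa [add_comm] using e'
  have hs : ∀ a b, fderiv ℝ (fderiv ℝ τ) z a b = fderiv ℝ (fderiv ℝ τ) z b a :=
    (hτ.of_le (by norm_num)).isSymmSndFDerivAt (n := 2) (by simp)
  have hs3 : ∀ a b, fderiv ℝ (fderiv ℝ (fderiv ℝ τ)) z a b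
      = fderiv ℝ (fderiv ℝ (fderiv ℝ τ)) z b a :=
    hJc.isSymmSndFDerivAt (by simp)
  have hl := hlaw.self_of_nhds
  -- Antisymmetrizing in `v, w` removes `D³τ`. The remaining `D²τ` terms cancel against those
  -- produced by the law in the quadratic part of the curvature.
  have k1 := eq_sub_of_add_eq' (key v w x)
  have k2 := eq_sub_of_add_eq' (key w v x)
  simp only [curvOp, map_sub, map_add, k1, k2, hl, hs3 w v, hs w v]
  abel

/-- The Christoffel map of `exp φ • B`, where `N` is the gradient of `φ`. -/
lemma IsLeviCivitaAt.conformal {B B' : E → E →L[ℝ] E →L[ℝ] ℝ} {Γ Γ' : E → E →L[ℝ] E →L[ℝ] E}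
    {φ : E → ℝ} {N : E → E} {z : E} (h : IsLeviCivitaAt B Γ z) (h' : IsLeviCivitaAt B' Γ' z)
    (hB : DifferentiableAt ℝ B z) (hB' : DifferentiableAt ℝ B' z)
    (hconf : ∀ y v w, B' y v w = Real.exp (φ y) * B y v w)
    (hnd : ∀ v, (∀ w, B z v w = 0) → v = 0)
    (hφ : DifferentiableAt ℝ φ z) (hN : ∀ x, B z (N z) x = fderiv ℝ φ z x) (v w : E) :
    Γ' z v w = Γ z v w
      + (1 / 2 : ℝ) • (fderiv ℝ φ z v • w + fderiv ℝ φ z w • v - B z v w • N z) := by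
  rw [← sub_eq_zero]
  apply hnd
  intro x
  -- The new Koszul formula is `exp φ` times the old one plus terms `dφ ⊗ B`; pairing the latter
  -- with a test vector gives the correction.
  have key (x v w : E) : fderiv ℝ B' z x v w
      = Real.exp (φ z) * (fderiv ℝ B z x v w + fderiv ℝ φ z x * B z v w) := by
    rw [← fderiv_apply₂ hB']
    have d : HasFDerivAt (fun y => B y v w) _ z :=
      (show DifferentiableAt ℝ (fun y => B y v w) z by fun_prop).hasFDerivAt
    simp only [hconf]
    rw [fderiv_fun_mul hφ.exp d.differentiableAt, hφ.hasFDerivAt.exp.fderiv]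
    simp [fderiv_apply₂ hB]
    ring
  have k := h v w x
  have k' := h' v w x
  simp only [key, hconf] at k'
  have hpos := Real.exp_pos (φ z)
  simp only [map_sub, map_add, map_smul, sub_apply, add_apply, smul_apply, smul_eq_mul, hN]
  apply mul_left_cancel₀ hpos.ne'
  linear_combination k' / 2 - Real.exp (φ z) * k / 2

/-- The curvature operator of `exp φ • B`, where `N` is the gradient of `φ`. -/
lemma curvOp_conformal {B : E → E →L[ℝ] E →L[ℝ] ℝ} {Γ Γ' : E → E →L[ℝ] E →L[ℝ] E}
    {φ : E → ℝ} {N : E → E} {z : E} (h : IsLeviCivitaAt B Γ z) (hB : DifferentiableAt ℝ B z)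
    (hsymm : ∀ y v w, B y v w = B y w v) (hnd : ∀ v, (∀ w, B z v w = 0) → v = 0)
    (hΓ : DifferentiableAt ℝ Γ z) (hΓ' : DifferentiableAt ℝ Γ' z)
    (hφ : ContDiffAt ℝ 2 φ z) (hN : DifferentiableAt ℝ N z)
    (hgrad : ∀ᶠ y in 𝓝 z, ∀ x, B y (N y) x = fderiv ℝ φ y x)
    (hlaw : ∀ᶠ y in 𝓝 z, ∀ v w, Γ' y v w = Γ y v w
      + (1 / 2 : ℝ) • (fderiv ℝ φ y v • w + fderiv ℝ φ y w • v - B y v w • N y))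
    (S : E → E) (hS : ∀ v, S v = fderiv ℝ N z v + Γ z v (N z)) (v w x : E) :
    curvOp Γ' z v w x = curvOp Γ z v w x
      + (1 / 2 : ℝ) • (B z (S x) v • w - B z (S x) w • v - B z w x • S v + B z v x • S w)
      + (1 / 4 : ℝ) • ((fderiv ℝ φ z w * fderiv ℝ φ z x) • v - (fderiv ℝ φ z v * fderiv ℝ φ z x) • w
        - fderiv ℝ φ z (N z) • (B z w x • v - B z v x • w)
        - (fderiv ℝ φ z w * B z v x) • N z + (fderiv ℝ φ z v * B z w x) • N z) := by
  have hDφ : DifferentiableAt ℝ (fderiv ℝ φ) z :=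
    (hφ.fderiv_right (m := 1) (by norm_num)).differentiableAt (by norm_num)
  have hαv (v : E) : HasFDerivAt (fun y => fderiv ℝ φ y v)
      ((ContinuousLinearMap.apply ℝ ℝ v).comp (fderiv ℝ (fderiv ℝ φ) z)) z :=
    (ContinuousLinearMap.apply ℝ ℝ v).hasFDerivAt.comp z hDφ.hasFDerivAt
  have compat := h.fderiv_eq hB hsymm
  have tor := h.torsionFree hB hsymm hnd
  have hg := hgrad.self_of_nhds
  -- Differentiating `B(N, x) = dφ(x)` and using metric compatibility identifies `S`, the covariant
  -- derivative of the gradient, with the Hessian of `φ`.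
  have hess (v x : E) : fderiv ℝ (fderiv ℝ φ) z v x = B z (S v) x + fderiv ℝ φ z (Γ z v x) := by
    have e : (fun y => B y (N y) x) =ᶠ[𝓝 z] fun y => fderiv ℝ φ y x := by
      filter_upwards [hgrad] with y hy using hy x
    have e' := congrArg (fun L => L v) (e.fderiv_eq (𝕜 := ℝ))
    simp only [hasFDerivAt_apply₂ hB hN.hasFDerivAt (hasFDerivAt_const x z), (hαv x).fderiv,
      compat] at e'
    simp at e'
    rw [← e', hS, map_add, add_apply, hg]
    ring
  have hs2 : ∀ a b, fderiv ℝ (fderiv ℝ φ) z a b = fderiv ℝ (fderiv ℝ φ) z b a :=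
    hφ.isSymmSndFDerivAt (by simp)
  -- `S` is self-adjoint because `D²φ` is symmetric and the connection is torsion free.
  have hSs (a b : E) : B z (S a) b = B z (S b) a := by
    have := hs2 a b
    rw [hess, hess, tor b a] at this
    linarith
  have key (v w x : E) : fderiv ℝ Γ' z v w x = fderiv ℝ Γ z v w x
      + (1 / 2 : ℝ) • ((B z (S v) w + fderiv ℝ φ z (Γ z v w)) • x
        + (B z (S v) x + fderiv ℝ φ z (Γ z v x)) • w
        - (B z (Γ z v w) x + B z w (Γ z v x)) • N z - B z w x • (S v - Γ z v (N z))) := by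
    have e : (fun y => Γ' y w x) =ᶠ[𝓝 z] fun y => Γ y w x
      + (1 / 2 : ℝ) • (fderiv ℝ φ y w • x + fderiv ℝ φ y x • w - B y w x • N y) := by
      filter_upwards [hlaw] with y hy using hy w x
    have d0 : HasFDerivAt (fun y => Γ y w x) _ z :=
      (show DifferentiableAt ℝ (fun y => Γ y w x) z by fun_prop).hasFDerivAt
    have dB : HasFDerivAt (fun y => B y w x) _ z :=
      (show DifferentiableAt ℝ (fun y => B y w x) z by fun_prop).hasFDerivAt
    have d := d0.add (((((hαv w).smul_const x).add ((hαv x).smul_const w)).sub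
      (dB.smul hN.hasFDerivAt)).const_smul (1 / 2 : ℝ))
    have e' := congrArg (fun L => L v) ((e.fderiv_eq (𝕜 := ℝ)).trans d.fderiv)
    simp only [fderiv_apply₂ hΓ'] at e'
    rw [e', hS]
    simp only [add_apply, fderiv_apply₂ hΓ, fderiv_apply₂ hB, smul_apply, sub_apply,
      ContinuousLinearMap.smulRight_apply, ContinuousLinearMap.comp_apply,
      ContinuousLinearMap.apply_apply, hess, compat, hS]
    congr 2
    module
  have hl := hlaw.self_of_nhds
  simp only [curvOp, key, hl, map_sub, map_add, map_smul, smul_eq_mul]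
  rw [tor w v, hSs x v, hSs x w, hSs w v, hsymm z w v, hsymm z w (Γ z v x), hsymm z v (Γ z w x),
    hsymm z w (N z), hsymm z v (N z), hg, hg]
  module

end Connection

end TotalScalar

namespace TotalScalar

/-! ### Coordinate expressions and operators -/

section Coordinates

variable {n : ℕ}

/-- The standard basis vectors of `ℝⁿ`. -/
abbrev stdE (i : Fin n) : EuclideanSpace ℝ (Fin n) := EuclideanSpace.single i 1

lemma eq_sum_stdE (v : EuclideanSpace ℝ (Fin n)) : v = ∑ i, v i • stdE i := by
  ext j
  simp [Pi.single_apply]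

lemma induction_stdE {p : EuclideanSpace ℝ (Fin n) → Prop} (h0 : p 0)
    (hadd : ∀ a b, p a → p b → p (a + b)) (hsmul : ∀ (c : ℝ) a, p a → p (c • a))
    (he : ∀ i, p (stdE i)) (v : EuclideanSpace ℝ (Fin n)) : p v := by
  rw [eq_sum_stdE v]
  exact Finset.sum_induction _ p hadd h0 fun i _ => hsmul _ _ (he i)

/-- The bilinear form with a given matrix. -/
def matrixBilin (A : Matrix (Fin n) (Fin n) ℝ) :
    EuclideanSpace ℝ (Fin n) →L[ℝ] EuclideanSpace ℝ (Fin n) →L[ℝ] ℝ :=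
  ∑ i, ∑ j, A i j • (EuclideanSpace.proj (𝕜 := ℝ) i).smulRight (EuclideanSpace.proj (𝕜 := ℝ) j)

lemma matrixBilin_apply (A : Matrix (Fin n) (Fin n) ℝ) (v w : EuclideanSpace ℝ (Fin n)) :
    matrixBilin A v w = ∑ i, ∑ j, A i j * (v i * w j) := by
  simp [matrixBilin]

@[simp] lemma matrixBilin_stdE (A : Matrix (Fin n) (Fin n) ℝ) (i j : Fin n) :
    matrixBilin A (stdE i) (stdE j) = A i j := by
  simp [matrixBilin_apply]

lemma matrixBilin_symm {A : Matrix (Fin n) (Fin n) ℝ} (hA : A.IsSymm)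
    (v w : EuclideanSpace ℝ (Fin n)) : matrixBilin A v w = matrixBilin A w v := by
  rw [matrixBilin_apply, matrixBilin_apply, Finset.sum_comm]
  refine Finset.sum_congr rfl fun i _ => Finset.sum_congr rfl fun j _ => ?_
  rw [hA.apply, mul_comm (v j)]

lemma matrixBilin_apply_stdE (A : Matrix (Fin n) (Fin n) ℝ) (v : EuclideanSpace ℝ (Fin n))
    (j : Fin n) : matrixBilin A v (stdE j) = ∑ i, A i j * v i := by
  simp [matrixBilin_apply]

lemma eq_zero_of_matrixBilin {A : Matrix (Fin n) (Fin n) ℝ} (hA : A.det ≠ 0)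
    (v : EuclideanSpace ℝ (Fin n)) (h : ∀ w, matrixBilin A v w = 0) : v = 0 := by
  have : Matrix.vecMul v.ofLp A = 0 := by
    ext j
    have := h (stdE j)
    rw [matrixBilin_apply_stdE] at this
    simpa [Matrix.vecMul, dotProduct, mul_comm] using this
  have h2 := Matrix.eq_zero_of_vecMul_eq_zero hA this
  ext i
  simpa using congrFun h2 i

/-- The Christoffel symbols as a bilinear map. -/
def christoffelMap (G : EuclideanSpace ℝ (Fin n) → Matrix (Fin n) (Fin n) ℝ)
    (z : EuclideanSpace ℝ (Fin n)) :
    EuclideanSpace ℝ (Fin n) →L[ℝ] EuclideanSpace ℝ (Fin n) →L[ℝ] EuclideanSpace ℝ (Fin n) :=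
  ∑ l, ∑ i, ∑ j, christoffel G l i j z • (EuclideanSpace.proj (𝕜 := ℝ) i).smulRight
    ((EuclideanSpace.proj (𝕜 := ℝ) j).smulRight (stdE l))

lemma christoffelMap_apply (G : EuclideanSpace ℝ (Fin n) → Matrix (Fin n) (Fin n) ℝ)
    (z v w : EuclideanSpace ℝ (Fin n)) (l : Fin n) :
    christoffelMap G z v w l = ∑ i, ∑ j, christoffel G l i j z * (v i * w j) := by
  simp [christoffelMap, Pi.single_apply]

@[simp] lemma christoffelMap_stdE (G : EuclideanSpace ℝ (Fin n) → Matrix (Fin n) (Fin n) ℝ)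
    (z : EuclideanSpace ℝ (Fin n)) (l i j : Fin n) :
    christoffelMap G z (stdE i) (stdE j) l = christoffel G l i j z := by
  simp [christoffelMap_apply]

/-! #### Regularity -/

section Regularity

variable {F : Type*} [NormedAddCommGroup F] [NormedSpace ℝ F] {A : F → Matrix (Fin n) (Fin n) ℝ}
  {z : F} {m : WithTop ℕ∞}

lemma contDiffAt_det (hA : ∀ i j, ContDiffAt ℝ m (fun w => A w i j) z) :
    ContDiffAt ℝ m (fun w => (A w).det) z := by
  simp only [Matrix.det_apply]
  refine ContDiffAt.sum fun σ _ => ContDiffAt.const_smul _ ?_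
  exact contDiffAt_prod fun i _ => hA _ _

lemma contDiffAt_inv (hA : ∀ i j, ContDiffAt ℝ m (fun w => A w i j) z) (hdet : (A z).det ≠ 0)
    (i j : Fin n) : ContDiffAt ℝ m (fun w => (A w)⁻¹ i j) z := by
  simp only [Matrix.inv_def, Ring.inverse_eq_inv', Matrix.smul_apply, smul_eq_mul,
    Matrix.adjugate_apply]
  refine ((contDiffAt_det hA).inv hdet).mul (contDiffAt_det fun a b => ?_)
  by_cases h : a = j
  · subst h
    simpa using contDiffAt_const
  · simpa [Matrix.updateRow_ne h] using hA a b

lemma contDiffAt_smul_const {F' : Type*} [NormedAddCommGroup F'] [NormedSpace ℝ F'] {f : F → ℝ}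
    (hf : ContDiffAt ℝ m f z) (L : F') : ContDiffAt ℝ m (fun w => f w • L) z :=
  hf.smul contDiffAt_const

end Regularity

/-! ### Metrics of class `C²` in coordinates and their Levi-Civita connection. -/

/-- The coefficients of a metric, nondegenerate and symmetric, of class `C²` at a point. -/
structure IsC2MetricAt (G : EuclideanSpace ℝ (Fin n) → Matrix (Fin n) (Fin n) ℝ)
    (z : EuclideanSpace ℝ (Fin n)) : Prop where
  contDiffAt : ∀ i j, ContDiffAt ℝ 2 (fun w => G w i j) z
  symm : ∀ w, (G w).IsSymm
  det_ne : (G z).det ≠ 0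

variable {G : EuclideanSpace ℝ (Fin n) → Matrix (Fin n) (Fin n) ℝ} {z : EuclideanSpace ℝ (Fin n)}

lemma contDiffAt_partialDeriv {f : EuclideanSpace ℝ (Fin n) → ℝ} (hf : ContDiffAt ℝ 2 f z)
    (k : Fin n) : ContDiffAt ℝ 1 (partialDeriv k f) z :=
  (hf.fderiv_right (m := 1) (by norm_num)).clm_apply contDiffAt_const

lemma fderiv_apply_eq_sum (f : EuclideanSpace ℝ (Fin n) → ℝ) (z v : EuclideanSpace ℝ (Fin n)) :
    fderiv ℝ f z v = ∑ k, v k * partialDeriv k f z := by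
  conv_lhs => rw [eq_sum_stdE v]
  simp [partialDeriv]

namespace IsC2MetricAt

/-- Regularity and nondegeneracy are open conditions. Curvature differentiates the Christoffel
symbols, so identities between them are needed on a neighbourhood, not just at `z`. -/
lemma eventually (h : IsC2MetricAt G z) : ∀ᶠ y in 𝓝 z, IsC2MetricAt G y := by
  have h1 : ∀ᶠ y in 𝓝 z, ∀ i j, ContDiffAt ℝ 2 (fun w => G w i j) y := by
    simp only [eventually_all]
    exact fun i j => (h.contDiffAt i j).eventually (by simp)
  have h2 : ∀ᶠ y in 𝓝 z, (G y).det ≠ 0 :=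
    (contDiffAt_det h.contDiffAt).continuousAt.eventually_ne h.det_ne
  filter_upwards [h1, h2] with y a b using ⟨a, h.symm, b⟩

lemma contDiffAt_christoffel (h : IsC2MetricAt G z) (l i j : Fin n) :
    ContDiffAt ℝ 1 (christoffel G l i j) z := by
  unfold christoffel
  refine contDiffAt_const.mul (ContDiffAt.sum fun m _ => ?_)
  refine ((contDiffAt_inv h.contDiffAt h.det_ne l m).of_le (by norm_num)).mul ?_
  exact ((contDiffAt_partialDeriv (h.contDiffAt _ _) _).add
    (contDiffAt_partialDeriv (h.contDiffAt _ _) _)).sub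
    (contDiffAt_partialDeriv (h.contDiffAt _ _) _)

lemma contDiffAt_matrixBilin (h : IsC2MetricAt G z) :
    ContDiffAt ℝ 2 (fun w => matrixBilin (G w)) z := by
  unfold matrixBilin
  exact ContDiffAt.sum fun i _ => ContDiffAt.sum fun j _ =>
    contDiffAt_smul_const (h.contDiffAt i j) _

lemma differentiableAt_matrixBilin (h : IsC2MetricAt G z) :
    DifferentiableAt ℝ (fun w => matrixBilin (G w)) z :=
  h.contDiffAt_matrixBilin.differentiableAt (by norm_num)

lemma contDiffAt_christoffelMap (h : IsC2MetricAt G z) :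
    ContDiffAt ℝ 1 (christoffelMap G) z := by
  unfold christoffelMap
  exact ContDiffAt.sum fun l _ => ContDiffAt.sum fun i _ => ContDiffAt.sum fun j _ =>
    contDiffAt_smul_const (h.contDiffAt_christoffel l i j) _

lemma differentiableAt_christoffelMap (h : IsC2MetricAt G z) :
    DifferentiableAt ℝ (christoffelMap G) z :=
  h.contDiffAt_christoffelMap.differentiableAt (by norm_num)

lemma bilin_symm (h : IsC2MetricAt G z) (y v w : EuclideanSpace ℝ (Fin n)) :
    matrixBilin (G y) v w = matrixBilin (G y) w v := matrixBilin_symm (h.symm y) v w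

lemma fderiv_matrixBilin (h : IsC2MetricAt G z) (k i j : Fin n) :
    fderiv ℝ (fun w => matrixBilin (G w)) z (stdE k) (stdE i) (stdE j)
      = partialDeriv k (fun w => G w i j) z := by
  rw [← fderiv_apply₂ h.differentiableAt_matrixBilin]
  simp [partialDeriv]

lemma fderiv_christoffelMap (h : IsC2MetricAt G z) (k l i j : Fin n) :
    fderiv ℝ (christoffelMap G) z (stdE k) (stdE i) (stdE j) l
      = partialDeriv k (christoffel G l i j) z := by
  rw [← fderiv_apply₂ h.differentiableAt_christoffelMap]
  have d : DifferentiableAt ℝ (fun y => christoffelMap G y (stdE i) (stdE j)) z := by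
    have := h.differentiableAt_christoffelMap
    fun_prop
  have e : christoffel G l i j
      = fun y => EuclideanSpace.proj (𝕜 := ℝ) l (christoffelMap G y (stdE i) (stdE j)) := by
    ext y
    simp
  rw [partialDeriv, e]
  have := ((EuclideanSpace.proj (𝕜 := ℝ) l).hasFDerivAt.comp z d.hasFDerivAt).fderiv
  exact (congrArg (fun L => L (stdE k)) this).symm

lemma sum_mul_inv (h : IsC2MetricAt G z) (a b : Fin n) :
    ∑ l, G z a l * (G z)⁻¹ l b = if a = b then 1 else 0 := by
  rw [← Matrix.mul_apply, Matrix.mul_nonsing_inv _ (isUnit_iff_ne_zero.2 h.det_ne),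
    Matrix.one_apply]

lemma inv_symm (h : IsC2MetricAt G z) (a b : Fin n) : (G z)⁻¹ a b = (G z)⁻¹ b a := by
  have : ((G z)⁻¹).IsSymm := by
    rw [Matrix.IsSymm, Matrix.transpose_nonsing_inv, h.symm z]
  exact this.apply b a

lemma lower_christoffel (h : IsC2MetricAt G z) (i j k : Fin n) :
    ∑ l, G z l k * christoffel G l i j z = (1 / 2 : ℝ) *
      (partialDeriv i (fun w => G w j k) z + partialDeriv j (fun w => G w i k) z
        - partialDeriv k (fun w => G w i j) z) := by
  simp only [christoffel, Finset.mul_sum]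
  rw [Finset.sum_comm]
  have : ∀ m, ∑ l, G z l k * (1 / 2 * ((G z)⁻¹ l m *
      (partialDeriv i (fun w => G w j m) z + partialDeriv j (fun w => G w i m) z
        - partialDeriv m (fun w => G w i j) z)))
      = (if k = m then 1 else 0) * (1 / 2 *
      (partialDeriv i (fun w => G w j m) z + partialDeriv j (fun w => G w i m) z
        - partialDeriv m (fun w => G w i j) z)) := by
    intro m
    rw [← h.sum_mul_inv, Finset.sum_mul]
    refine Finset.sum_congr rfl fun l _ => ?_
    rw [(h.symm z).apply]
    ring
  rw [Finset.sum_congr rfl fun m _ => this m]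
  simp

lemma isLeviCivitaAt (h : IsC2MetricAt G z) :
    IsLeviCivitaAt (fun w => matrixBilin (G w)) (christoffelMap G) z := by
  -- Both sides are trilinear, so three inductions reduce the Koszul formula to basis vectors, where
  -- it is `lower_christoffel`.
  intro v
  induction v using induction_stdE with
  | h0 => simp
  | hadd a b ha hb =>
    intro w x
    have h1 := ha w x
    have h2 := hb w x
    simp only [map_add, add_apply] at h1 h2 ⊢
    linarith
  | hsmul c a ha =>
    intro w x
    have h1 := ha w x
    simp only [map_smul, smul_apply, smul_eq_mul] at h1 ⊢
    linear_combination c * h1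
  | he i =>
  intro w
  induction w using induction_stdE with
  | h0 => simp
  | hadd a b ha hb =>
    intro x
    have h1 := ha x
    have h2 := hb x
    simp only [map_add, add_apply] at h1 h2 ⊢
    linarith
  | hsmul c a ha =>
    intro x
    have h1 := ha x
    simp only [map_smul, smul_apply, smul_eq_mul] at h1 ⊢
    linear_combination c * h1
  | he j =>
  intro x
  induction x using induction_stdE with
  | h0 => simp
  | hadd a b ha hb =>
    simp only [map_add, add_apply] at ha hb ⊢
    linarith
  | hsmul c a ha =>
    simp only [map_smul, smul_apply, smul_eq_mul] at ha ⊢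
    linear_combination c * ha
  | he k =>
  simp only [h.fderiv_matrixBilin, matrixBilin_apply_stdE, christoffelMap_stdE]
  rw [h.lower_christoffel]
  ring

/-- `∂_k g_ij = ∑_l (Γ^l_ki g_lj + Γ^l_kj g_il)`. -/
lemma partialDeriv_eq (h : IsC2MetricAt G z) (k i j : Fin n) :
    partialDeriv k (fun w => G w i j) z
      = ∑ l, (christoffel G l k i z * G z l j + christoffel G l k j z * G z i l) := by
  have := h.isLeviCivitaAt.fderiv_eq h.differentiableAt_matrixBilin h.bilin_symm
    (stdE k) (stdE i) (stdE j)
  rw [h.fderiv_matrixBilin, h.bilin_symm z (stdE i), matrixBilin_apply_stdE,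
    matrixBilin_apply_stdE, ← Finset.sum_add_distrib] at this
  rw [this]
  refine Finset.sum_congr rfl fun l _ => ?_
  rw [christoffelMap_stdE, christoffelMap_stdE, (h.symm z).apply l i]
  ring

end IsC2MetricAt

end Coordinates

end TotalScalar

namespace TotalScalar

section CoordinateCurvature

variable {n : ℕ} {G : EuclideanSpace ℝ (Fin n) → Matrix (Fin n) (Fin n) ℝ}
  {z : EuclideanSpace ℝ (Fin n)}

/-! #### The scalar curvature as a contraction -/

lemma riemannCoeff_eq (h : IsC2MetricAt G z) (l k i j : Fin n) :
    riemannCoeff G l k i j z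
      = curvOp (christoffelMap G) z (stdE i) (stdE j) (stdE k) l := by
  have key (a : Fin n) (v : EuclideanSpace ℝ (Fin n)) :
      christoffelMap G z (stdE a) v l = ∑ m, christoffel G l a m z * v m := by
    simp [christoffelMap_apply]
  simp only [riemannCoeff, curvOp, PiLp.sub_apply, PiLp.add_apply, h.fderiv_christoffelMap, key,
    christoffelMap_stdE, Finset.sum_sub_distrib]
  ring

/-- The Ricci form `Ric(w, x)`, i.e. the trace of `v ↦ R(v, w) x`. -/
def ricciForm (Γ : EuclideanSpace ℝ (Fin n) → EuclideanSpace ℝ (Fin n) →L[ℝ]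
    EuclideanSpace ℝ (Fin n) →L[ℝ] EuclideanSpace ℝ (Fin n)) (z : EuclideanSpace ℝ (Fin n)) :
    EuclideanSpace ℝ (Fin n) →ₗ[ℝ] EuclideanSpace ℝ (Fin n) →ₗ[ℝ] ℝ :=
  LinearMap.mk₂ ℝ (fun w x => ∑ i, curvOp Γ z (stdE i) w x i)
    (fun a b x => by
      rw [← Finset.sum_add_distrib]
      refine Finset.sum_congr rfl fun i _ => ?_
      simp only [curvOp, map_add, add_apply, PiLp.sub_apply, PiLp.add_apply]
      ring)
    (fun c a x => by
      rw [Finset.smul_sum]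
      refine Finset.sum_congr rfl fun i _ => ?_
      simp only [curvOp, map_smul, smul_apply, PiLp.sub_apply, PiLp.add_apply, PiLp.smul_apply,
        smul_eq_mul]
      ring)
    (fun a b x => by
      rw [← Finset.sum_add_distrib]
      refine Finset.sum_congr rfl fun i _ => ?_
      simp only [curvOp, map_add, PiLp.sub_apply, PiLp.add_apply]
      ring)
    (fun c a x => by
      rw [Finset.smul_sum]
      refine Finset.sum_congr rfl fun i _ => ?_
      simp only [curvOp, map_smul, PiLp.sub_apply, PiLp.add_apply, PiLp.smul_apply,
        smul_eq_mul]
      ring)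

lemma localScalarCurvature_eq (h : IsC2MetricAt G z) :
    localScalarCurvature G z
      = ∑ j, ∑ k, (G z)⁻¹ j k * ricciForm (christoffelMap G) z (stdE j) (stdE k) := by
  simp only [localScalarCurvature, ricciCoeff, riemannCoeff_eq h, ricciForm, LinearMap.mk₂_apply]

/-! #### Change of coordinates -/

/-- The matrix of an endomorphism of `ℝⁿ`. -/
def stdMatrix (L : EuclideanSpace ℝ (Fin n) →L[ℝ] EuclideanSpace ℝ (Fin n)) :
    Matrix (Fin n) (Fin n) ℝ :=
  Matrix.of fun k i => L (stdE i) k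

lemma stdMatrix_mulVec (L : EuclideanSpace ℝ (Fin n) →L[ℝ] EuclideanSpace ℝ (Fin n))
    (v : EuclideanSpace ℝ (Fin n)) : stdMatrix L *ᵥ v.ofLp = (L v).ofLp := by
  ext k
  conv_rhs => rw [eq_sum_stdE v]
  simp [Matrix.mulVec, dotProduct, stdMatrix, mul_comm]

lemma bijective_of_det_stdMatrix {L : EuclideanSpace ℝ (Fin n) →L[ℝ] EuclideanSpace ℝ (Fin n)}
    (hL : (stdMatrix L).det ≠ 0) : Function.Bijective L := by
  have hu : IsUnit (stdMatrix L) := (Matrix.isUnit_iff_isUnit_det _).2 (isUnit_iff_ne_zero.2 hL)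
  constructor
  · intro v w hvw
    have := Matrix.mulVec_injective_iff_isUnit.2 hu
      (a₁ := v.ofLp) (a₂ := w.ofLp) (by rw [stdMatrix_mulVec, stdMatrix_mulVec, hvw])
    ext i
    exact congrFun this i
  · intro w
    obtain ⟨v, hv⟩ := Matrix.mulVec_surjective_iff_isUnit.2 hu w.ofLp
    refine ⟨WithLp.toLp 2 v, ?_⟩
    have := stdMatrix_mulVec L (WithLp.toLp 2 v)
    ext i
    rw [← this]
    exact congrFun hv i

/-- Produces the congruence `Pᵀ T P` required by `sum_inv_mul_congr`; it is applied to metrics, to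
the Ricci form and to `du ⊗ du`. -/
lemma bilinear_comp_matrix
    (f : EuclideanSpace ℝ (Fin n) →ₗ[ℝ] EuclideanSpace ℝ (Fin n) →ₗ[ℝ] ℝ)
    (L : EuclideanSpace ℝ (Fin n) →L[ℝ] EuclideanSpace ℝ (Fin n)) :
    (Matrix.of fun i j => f (L (stdE i)) (L (stdE j)))
      = (stdMatrix L)ᵀ * (Matrix.of fun i j => f (stdE i) (stdE j)) * stdMatrix L := by
  ext i j
  rw [Matrix.of_apply, eq_sum_stdE (L (stdE i)), eq_sum_stdE (L (stdE j))]
  simp only [map_sum, map_smul, LinearMap.sum_apply, LinearMap.smul_apply, smul_eq_mul,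
    Matrix.mul_apply, Matrix.transpose_apply, Matrix.of_apply, stdMatrix, Finset.sum_mul,
    Finset.mul_sum]
  refine Finset.sum_congr rfl fun a _ => Finset.sum_congr rfl fun b _ => ?_
  ring

lemma matrixBilin_pullback (A : Matrix (Fin n) (Fin n) ℝ)
    (L : EuclideanSpace ℝ (Fin n) →L[ℝ] EuclideanSpace ℝ (Fin n))
    (v w : EuclideanSpace ℝ (Fin n)) :
    matrixBilin ((stdMatrix L)ᵀ * A * stdMatrix L) v w = matrixBilin A (L v) (L w) := by
  have := bilinear_comp_matrix (LinearMap.mk₂ ℝ (fun v w => matrixBilin A v w) (by simp) (by simp)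
    (by simp) (by simp)) L
  have hA : (Matrix.of fun i j => matrixBilin A (stdE i) (stdE j)) = A := by
    ext i j
    simp
  simp only [LinearMap.mk₂_apply, hA] at this
  rw [← this, matrixBilin_apply]
  conv_rhs => rw [eq_sum_stdE v, eq_sum_stdE w]
  simp only [map_sum, map_smul, sum_apply, smul_apply, smul_eq_mul, Matrix.of_apply,
    Finset.mul_sum]
  rw [Finset.sum_comm]
  refine Finset.sum_congr rfl fun a _ => Finset.sum_congr rfl fun b _ => ?_
  ring

/-- Full contractions with the inverse metric do not depend on the basis: the sum is the trace of `X
Yᵀ`, and the factors `P` cancel by cyclicity. `Matrix.mul_inv_rev` needs no invertibility, so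
nothing is assumed of `A`. -/
lemma sum_inv_mul_congr (A P T : Matrix (Fin n) (Fin n) ℝ) (hP : P.det ≠ 0) :
    ∑ j, ∑ k, (Pᵀ * A * P)⁻¹ j k * (Pᵀ * T * P) j k = ∑ j, ∑ k, A⁻¹ j k * T j k := by
  have tr (X Y : Matrix (Fin n) (Fin n) ℝ) : ∑ j, ∑ k, X j k * Y j k = (X * Yᵀ).trace := by
    simp [Matrix.trace, Matrix.mul_apply]
  have hu : IsUnit P.det := isUnit_iff_ne_zero.2 hP
  have hu' : IsUnit (Pᵀ).det := by rwa [Matrix.det_transpose]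
  rw [tr, tr, Matrix.mul_inv_rev, Matrix.mul_inv_rev]
  simp only [Matrix.transpose_mul, Matrix.transpose_transpose]
  have : P⁻¹ * (A⁻¹ * (Pᵀ)⁻¹) * (Pᵀ * (Tᵀ * P)) = P⁻¹ * (A⁻¹ * Tᵀ * P) := by
    simp only [Matrix.mul_assoc]
    rw [← Matrix.mul_assoc (Pᵀ)⁻¹, Matrix.nonsing_inv_mul _ hu', Matrix.one_mul]
  rw [this, Matrix.trace_mul_comm, Matrix.mul_assoc, Matrix.mul_nonsing_inv _ hu, Matrix.mul_one]

lemma sum_stdE_eq_trace (T : EuclideanSpace ℝ (Fin n) →ₗ[ℝ] EuclideanSpace ℝ (Fin n)) :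
    ∑ i, T (stdE i) i = LinearMap.trace ℝ _ T := by
  rw [LinearMap.trace_eq_matrix_trace ℝ (EuclideanSpace.basisFun (Fin n) ℝ).toBasis]
  simp [Matrix.trace, LinearMap.toMatrix_apply]

/-- `v ↦ R(v, w) x`. -/
def curvEnd (Γ : EuclideanSpace ℝ (Fin n) → EuclideanSpace ℝ (Fin n) →L[ℝ]
    EuclideanSpace ℝ (Fin n) →L[ℝ] EuclideanSpace ℝ (Fin n))
    (z w x : EuclideanSpace ℝ (Fin n)) :
    EuclideanSpace ℝ (Fin n) →ₗ[ℝ] EuclideanSpace ℝ (Fin n) where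
  toFun v := curvOp Γ z v w x
  map_add' a b := by
    simp only [curvOp, map_add, add_apply]
    abel
  map_smul' c a := by
    simp only [curvOp, map_smul, smul_apply, RingHom.id_apply, smul_sub, smul_add]

lemma ricciForm_eq_trace (Γ : EuclideanSpace ℝ (Fin n) → EuclideanSpace ℝ (Fin n) →L[ℝ]
    EuclideanSpace ℝ (Fin n) →L[ℝ] EuclideanSpace ℝ (Fin n))
    (z w x : EuclideanSpace ℝ (Fin n)) :
    ricciForm Γ z w x = LinearMap.trace ℝ _ (curvEnd Γ z w x) := by
  rw [← sum_stdE_eq_trace]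
  rfl

/-- The scalar curvature does not depend on the coordinates. -/
lemma localScalarCurvature_transform {G' : EuclideanSpace ℝ (Fin n) → Matrix (Fin n) (Fin n) ℝ}
    {τ : EuclideanSpace ℝ (Fin n) → EuclideanSpace ℝ (Fin n)}
    (h : IsC2MetricAt G (τ z)) (h' : IsC2MetricAt G' z) (hτ : ContDiffAt ℝ 3 τ z)
    (hpull : ∀ᶠ y in 𝓝 z,
      G' y = (stdMatrix (fderiv ℝ τ y))ᵀ * G (τ y) * stdMatrix (fderiv ℝ τ y)) :
    localScalarCurvature G' z = localScalarCurvature G (τ z) := by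
  -- Nondegeneracy of the pulled back metric already forces `Dτ` to be invertible.
  have hdet {y} (h1 : G' y = (stdMatrix (fderiv ℝ τ y))ᵀ * G (τ y) * stdMatrix (fderiv ℝ τ y))
      (h2 : (G' y).det ≠ 0) : (stdMatrix (fderiv ℝ τ y)).det ≠ 0 := by
    intro h3
    rw [h1, Matrix.det_mul, h3, mul_zero] at h2
    exact h2 rfl
  have hP := hdet hpull.self_of_nhds h'.det_ne
  have hbij := bijective_of_det_stdMatrix hP
  have hlaw : ∀ᶠ y in 𝓝 z, ∀ v w, fderiv ℝ τ y (christoffelMap G' y v w)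
      = christoffelMap G (τ y) (fderiv ℝ τ y v) (fderiv ℝ τ y w)
        + fderiv ℝ (fderiv ℝ τ) y v w := by
    filter_upwards [hτ.continuousAt.eventually h.eventually, h'.eventually,
      hτ.eventually (by simp), hpull.eventually_nhds] with y hy hy' hτy hpy v w
    refine hy'.isLeviCivitaAt.transform hy.isLeviCivitaAt hy.differentiableAt_matrixBilin
      hy'.differentiableAt_matrixBilin hy.bilin_symm (eq_zero_of_matrixBilin hy.det_ne)
      (hτy.of_le (by norm_num))
      (bijective_of_det_stdMatrix (hdet hpy.self_of_nhds hy'.det_ne)).2 ?_ v w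
    filter_upwards [hpy] with x hx v w
    rw [hx, matrixBilin_pullback]
  have hcurv := curvOp_transform hτ h.differentiableAt_christoffelMap
    h'.differentiableAt_christoffelMap hlaw
  have hric (w x : EuclideanSpace ℝ (Fin n)) : ricciForm (christoffelMap G') z w x
      = ricciForm (christoffelMap G) (τ z) (fderiv ℝ τ z w) (fderiv ℝ τ z x) := by
    rw [ricciForm_eq_trace, ricciForm_eq_trace]
    let e := LinearEquiv.ofBijective (fderiv ℝ τ z).toLinearMap hbij
    -- The endomorphisms `v ↦ R(v, w) x` in the two coordinate systems are conjugate by `Dτ`, so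
    -- their traces agree.
    rw [← LinearMap.trace_conj' (curvEnd (christoffelMap G') z w x) e]
    congr 1
    ext1 v
    obtain ⟨v, rfl⟩ := e.surjective v
    rw [LinearEquiv.conj_apply_apply, LinearEquiv.symm_apply_apply]
    exact hcurv v w x
  rw [localScalarCurvature_eq h, localScalarCurvature_eq h', hpull.self_of_nhds]
  have := sum_inv_mul_congr (G (τ z)) _
    (Matrix.of fun i j => ricciForm (christoffelMap G) (τ z) (stdE i) (stdE j)) hP
  rw [← bilinear_comp_matrix] at this
  simpa only [hric, Matrix.of_apply] using this

/-! #### Gradients, Laplacians and conformal changes -/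

/-- The gradient of a function, in coordinates. -/
def localGrad (G : EuclideanSpace ℝ (Fin n) → Matrix (Fin n) (Fin n) ℝ)
    (φ : EuclideanSpace ℝ (Fin n) → ℝ) (z : EuclideanSpace ℝ (Fin n)) :
    EuclideanSpace ℝ (Fin n) :=
  ∑ l, (∑ m, (G z)⁻¹ l m * partialDeriv m φ z) • stdE l

/-- The squared norm of the differential of a function, in coordinates. -/
def localGradSq (G : EuclideanSpace ℝ (Fin n) → Matrix (Fin n) (Fin n) ℝ)
    (φ : EuclideanSpace ℝ (Fin n) → ℝ) (z : EuclideanSpace ℝ (Fin n)) : ℝ :=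
  ∑ j, ∑ k, (G z)⁻¹ j k * (partialDeriv j φ z * partialDeriv k φ z)

/-- The covariant derivative of the gradient of a function, in coordinates. -/
def localHess (G : EuclideanSpace ℝ (Fin n) → Matrix (Fin n) (Fin n) ℝ)
    (φ : EuclideanSpace ℝ (Fin n) → ℝ) (z : EuclideanSpace ℝ (Fin n)) :
    EuclideanSpace ℝ (Fin n) →L[ℝ] EuclideanSpace ℝ (Fin n) :=
  fderiv ℝ (localGrad G φ) z + (christoffelMap G z).flip (localGrad G φ z)

/-- The Laplace-Beltrami operator, in coordinates. -/
def localLaplacian (G : EuclideanSpace ℝ (Fin n) → Matrix (Fin n) (Fin n) ℝ)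
    (φ : EuclideanSpace ℝ (Fin n) → ℝ) (z : EuclideanSpace ℝ (Fin n)) : ℝ :=
  ∑ i, localHess G φ z (stdE i) i

variable {φ : EuclideanSpace ℝ (Fin n) → ℝ}

lemma localGrad_apply (G : EuclideanSpace ℝ (Fin n) → Matrix (Fin n) (Fin n) ℝ)
    (φ : EuclideanSpace ℝ (Fin n) → ℝ) (z : EuclideanSpace ℝ (Fin n)) (l : Fin n) :
    localGrad G φ z l = ∑ m, (G z)⁻¹ l m * partialDeriv m φ z := by
  simp [localGrad, Pi.single_apply]

lemma matrixBilin_localGrad (h : IsC2MetricAt G z) (φ : EuclideanSpace ℝ (Fin n) → ℝ)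
    (x : EuclideanSpace ℝ (Fin n)) :
    matrixBilin (G z) (localGrad G φ z) x = fderiv ℝ φ z x := by
  rw [h.bilin_symm, fderiv_apply_eq_sum, matrixBilin_apply]
  refine Finset.sum_congr rfl fun i _ => ?_
  simp only [localGrad_apply, Finset.mul_sum]
  rw [Finset.sum_comm]
  have : ∀ m, ∑ l, G z i l * (x i * ((G z)⁻¹ l m * partialDeriv m φ z))
      = (if i = m then 1 else 0) * (x i * partialDeriv m φ z) := by
    intro m
    rw [← h.sum_mul_inv, Finset.sum_mul]
    refine Finset.sum_congr rfl fun l _ => ?_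
    ring
  rw [Finset.sum_congr rfl fun m _ => this m]
  simp

lemma contDiffAt_localGrad (h : IsC2MetricAt G z) (hφ : ContDiffAt ℝ 2 φ z) :
    ContDiffAt ℝ 1 (localGrad G φ) z := by
  unfold localGrad
  exact ContDiffAt.sum fun l _ => contDiffAt_smul_const (ContDiffAt.sum fun m _ =>
    ((contDiffAt_inv h.contDiffAt h.det_ne l m).of_le (by norm_num)).mul
      (contDiffAt_partialDeriv hφ m)) _

lemma fderiv_localGrad (G : EuclideanSpace ℝ (Fin n) → Matrix (Fin n) (Fin n) ℝ)
    (φ : EuclideanSpace ℝ (Fin n) → ℝ) (z : EuclideanSpace ℝ (Fin n)) :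
    fderiv ℝ φ z (localGrad G φ z) = localGradSq G φ z := by
  rw [fderiv_apply_eq_sum, localGradSq]
  refine Finset.sum_congr rfl fun j _ => ?_
  rw [localGrad_apply, Finset.sum_mul]
  refine Finset.sum_congr rfl fun k _ => ?_
  ring

/-- The Ricci form of the conformal metric `exp φ • G`. -/
lemma ricciForm_conformal (h : IsC2MetricAt G z) (hφ : ContDiffAt ℝ 2 φ z)
    (h' : IsC2MetricAt (fun w => Real.exp (φ w) • G w) z) (w x : EuclideanSpace ℝ (Fin n)) :
    ricciForm (christoffelMap fun w => Real.exp (φ w) • G w) z w x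
      = ricciForm (christoffelMap G) z w x
        + (1 / 2 : ℝ) * ((1 - n) * matrixBilin (G z) (localHess G φ z x) w
          + matrixBilin (G z) (localHess G φ z w) x - localLaplacian G φ z * matrixBilin (G z) w x)
        + (n - 2) / 4 * (fderiv ℝ φ z w * fderiv ℝ φ z x
          - localGradSq G φ z * matrixBilin (G z) w x) := by
  have hlaw : ∀ᶠ y in 𝓝 z, ∀ v w, christoffelMap (fun w => Real.exp (φ w) • G w) y v w
      = christoffelMap G y v w + (1 / 2 : ℝ) • (fderiv ℝ φ y v • w + fderiv ℝ φ y w • v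
        - matrixBilin (G y) v w • localGrad G φ y) := by
    filter_upwards [h.eventually, h'.eventually, hφ.eventually (by simp)] with y hy hy' hφy v w
    refine hy.isLeviCivitaAt.conformal hy'.isLeviCivitaAt hy.differentiableAt_matrixBilin
      hy'.differentiableAt_matrixBilin (fun y v w => ?_) (eq_zero_of_matrixBilin hy.det_ne)
      (hφy.differentiableAt (by norm_num)) (matrixBilin_localGrad hy φ) v w
    simp only [matrixBilin_apply, Finset.mul_sum, Matrix.smul_apply, smul_eq_mul]
    refine Finset.sum_congr rfl fun a _ => Finset.sum_congr rfl fun b _ => ?_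
    ring
  have hgrad : ∀ᶠ y in 𝓝 z, ∀ x, matrixBilin (G y) (localGrad G φ y) x = fderiv ℝ φ y x := by
    filter_upwards [h.eventually] with y hy using matrixBilin_localGrad hy φ
  have key := fun v => curvOp_conformal h.isLeviCivitaAt h.differentiableAt_matrixBilin
    h.bilin_symm (eq_zero_of_matrixBilin h.det_ne) h.differentiableAt_christoffelMap
    h'.differentiableAt_christoffelMap hφ
    ((contDiffAt_localGrad h hφ).differentiableAt (by norm_num)) hgrad hlaw (localHess G φ z)
    (fun v => rfl) v w x
  -- The trace is taken over `v = e_i`. Up to constants, every correction term is `L(e_i) y_i` for a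
  -- functional `L` and a vector `y`, summing to `L y`, or the diagonal of `localHess`, giving the
  -- Laplacian, or `δ_ii`, giving `n`.
  have contr (L : EuclideanSpace ℝ (Fin n) →L[ℝ] ℝ) (y : EuclideanSpace ℝ (Fin n)) :
      ∑ i, L (stdE i) * y i = L y := by
    conv_rhs => rw [eq_sum_stdE y]
    simp [mul_comm]
  have c1 := contr (matrixBilin (G z) (localHess G φ z x)) w
  have c2 := contr ((matrixBilin (G z)).flip x) (localHess G φ z w)
  have c3 := contr (fderiv ℝ φ z) w
  have c4 := contr ((matrixBilin (G z)).flip x) w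
  have c5 := contr ((matrixBilin (G z)).flip x) (localGrad G φ z)
  have c6 := contr (fderiv ℝ φ z) (localGrad G φ z)
  have c7 : ∑ i, stdE (n := n) i i = n := by simp
  simp only [ContinuousLinearMap.flip_apply] at c2 c4 c5
  rw [matrixBilin_localGrad h] at c5
  rw [fderiv_localGrad] at c6
  simp only [ricciForm, LinearMap.mk₂_apply, key]
  have e (i : Fin n) : (curvOp (christoffelMap G) z (stdE i) w x + (1 / 2 : ℝ) •
      (matrixBilin (G z) (localHess G φ z x) (stdE i) • w
        - matrixBilin (G z) (localHess G φ z x) w • stdE i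
        - matrixBilin (G z) w x • localHess G φ z (stdE i)
        + matrixBilin (G z) (stdE i) x • localHess G φ z w)
      + (1 / 4 : ℝ) • ((fderiv ℝ φ z w * fderiv ℝ φ z x) • stdE i
        - (fderiv ℝ φ z (stdE i) * fderiv ℝ φ z x) • w
        - fderiv ℝ φ z (localGrad G φ z) •
          (matrixBilin (G z) w x • stdE i - matrixBilin (G z) (stdE i) x • w)
        - (fderiv ℝ φ z w * matrixBilin (G z) (stdE i) x) • localGrad G φ z
        + (fderiv ℝ φ z (stdE i) * matrixBilin (G z) w x) • localGrad G φ z)) i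
      = curvOp (christoffelMap G) z (stdE i) w x i
        + (1 / 2) * (matrixBilin (G z) (localHess G φ z x) (stdE i) * w i)
        + (1 / 2) * (matrixBilin (G z) (stdE i) x * localHess G φ z w i)
        - (1 / 4 * fderiv ℝ φ z x) * (fderiv ℝ φ z (stdE i) * w i)
        + (1 / 4 * localGradSq G φ z) * (matrixBilin (G z) (stdE i) x * w i)
        - (1 / 4 * fderiv ℝ φ z w) * (matrixBilin (G z) (stdE i) x * localGrad G φ z i)
        + (1 / 4 * matrixBilin (G z) w x) * (fderiv ℝ φ z (stdE i) * localGrad G φ z i)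
        - (1 / 2 * matrixBilin (G z) w x) * localHess G φ z (stdE i) i
        + (1 / 4 * (fderiv ℝ φ z w * fderiv ℝ φ z x - localGradSq G φ z * matrixBilin (G z) w x)
          - 1 / 2 * matrixBilin (G z) (localHess G φ z x) w) * stdE (n := n) i i := by
    rw [fderiv_localGrad]
    simp only [PiLp.add_apply, PiLp.sub_apply, PiLp.smul_apply, smul_eq_mul]
    ring
  simp only [e, Finset.sum_add_distrib, Finset.sum_sub_distrib, ← Finset.mul_sum, c1, c2, c3, c4,
    c5, c6, c7]
  rw [← localLaplacian]
  ring

lemma IsC2MetricAt.conformal (h : IsC2MetricAt G z) (hφ : ContDiffAt ℝ 2 φ z) :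
    IsC2MetricAt (fun w => Real.exp (φ w) • G w) z where
  contDiffAt i j := hφ.exp.mul (h.contDiffAt i j)
  symm w := (h.symm w).smul _
  det_ne := by
    rw [Matrix.det_smul]
    exact mul_ne_zero (pow_ne_zero _ (Real.exp_pos _).ne') h.det_ne

/-- Lowering an index and contracting with the inverse metric leaves the trace of `L`. For the
Hessian this is the Laplacian, for the identity it is `n`. -/
lemma IsC2MetricAt.contr_matrixBilin (h : IsC2MetricAt G z)
    (L : EuclideanSpace ℝ (Fin n) →L[ℝ] EuclideanSpace ℝ (Fin n)) :
    ∑ j, ∑ k, (G z)⁻¹ j k * matrixBilin (G z) (L (stdE j)) (stdE k) = ∑ i, L (stdE i) i := by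
  refine Finset.sum_congr rfl fun j _ => ?_
  simp only [matrixBilin_apply_stdE, Finset.mul_sum]
  rw [Finset.sum_comm]
  have : ∀ l, ∑ k, (G z)⁻¹ j k * (G z l k * L (stdE j) l)
      = (if l = j then 1 else 0) * L (stdE j) l := by
    intro l
    rw [← h.sum_mul_inv, Finset.sum_mul]
    refine Finset.sum_congr rfl fun k _ => ?_
    rw [h.inv_symm j k]
    ring
  rw [Finset.sum_congr rfl fun l _ => this l]
  simp

/-- The scalar curvature of the conformal metric `exp φ • G`. -/
lemma localScalarCurvature_conformal (h : IsC2MetricAt G z) (hφ : ContDiffAt ℝ 2 φ z) :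
    localScalarCurvature (fun w => Real.exp (φ w) • G w) z
      = Real.exp (-φ z) * (localScalarCurvature G z - (n - 1) * localLaplacian G φ z
        - (n - 1) * (n - 2) / 4 * localGradSq G φ z) := by
  have h' := h.conformal hφ
  have hinv : (Real.exp (φ z) • G z)⁻¹ = Real.exp (-φ z) • (G z)⁻¹ := by
    apply Matrix.inv_eq_right_inv
    rw [Matrix.smul_mul, Matrix.mul_smul, smul_smul, ← Real.exp_add, add_neg_cancel, Real.exp_zero,
      one_smul, Matrix.mul_nonsing_inv _ (isUnit_iff_ne_zero.2 h.det_ne)]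
  have d1 := h.contr_matrixBilin (localHess G φ z)
  have d2 : ∑ j, ∑ k, (G z)⁻¹ j k * matrixBilin (G z) (localHess G φ z (stdE k)) (stdE j)
      = ∑ i, localHess G φ z (stdE i) i := by
    rw [← d1, Finset.sum_comm]
    simp only [h.inv_symm]
  have d3 : ∑ j, ∑ k, (G z)⁻¹ j k * G z j k = n := by
    have := h.contr_matrixBilin (ContinuousLinearMap.id ℝ _)
    simpa using this
  rw [localScalarCurvature_eq h, localScalarCurvature_eq h', hinv]
  have e (j k : Fin n) : (Real.exp (-φ z) • (G z)⁻¹) j k *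
      ricciForm (christoffelMap fun w => Real.exp (φ w) • G w) z (stdE j) (stdE k)
      = Real.exp (-φ z) * ((G z)⁻¹ j k * ricciForm (christoffelMap G) z (stdE j) (stdE k))
        + (Real.exp (-φ z) * ((1 - n) / 2)) *
          ((G z)⁻¹ j k * matrixBilin (G z) (localHess G φ z (stdE k)) (stdE j))
        + (Real.exp (-φ z) / 2) *
          ((G z)⁻¹ j k * matrixBilin (G z) (localHess G φ z (stdE j)) (stdE k))
        - (Real.exp (-φ z) * (localLaplacian G φ z / 2 + (n - 2) / 4 * localGradSq G φ z))
          * ((G z)⁻¹ j k * G z j k)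
        + (Real.exp (-φ z) * ((n - 2) / 4)) *
          ((G z)⁻¹ j k * (partialDeriv j φ z * partialDeriv k φ z)) := by
    rw [ricciForm_conformal h hφ h', matrixBilin_stdE, Matrix.smul_apply, smul_eq_mul,
      partialDeriv, partialDeriv]
    ring
  -- The Laplacian collects `(1 - n)/2 + 1/2 - n/2 = -(n - 1)`, and `|dφ|²` collects `(n - 2)/4 · (1
  -- - n)`.
  simp only [e, Finset.sum_add_distrib, Finset.sum_sub_distrib, ← Finset.mul_sum, d1, d2, d3]
  rw [← localLaplacian, ← localGradSq]
  ring

/-! #### The volume density -/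

/-- Jacobi's formula: the determinant is multilinear in the rows, so its derivative replaces one row
at a time, and Cramer's rule turns each summand into adjugate entries. -/
lemma fderiv_det {A : EuclideanSpace ℝ (Fin n) → Matrix (Fin n) (Fin n) ℝ}
    (hA : ∀ i j, DifferentiableAt ℝ (fun w => A w i j) z) (v : EuclideanSpace ℝ (Fin n)) :
    fderiv ℝ (fun w => (A w).det) z v
      = ∑ i, ∑ j, (A z).adjugate j i * fderiv ℝ (fun w => A w i j) z v := by
  let D : ContinuousMultilinearMap ℝ (fun _ : Fin n => Fin n → ℝ) ℝ :=
    { (Matrix.detRowAlternating : (Fin n → ℝ) [⋀^Fin n]→ₗ[ℝ] ℝ).toMultilinearMap with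
      cont := by
        change Continuous fun M : Matrix (Fin n) (Fin n) ℝ => M.det
        exact continuous_id.matrix_det }
  have hA' : DifferentiableAt ℝ (fun w i j => A w i j) z := by
    rw [differentiableAt_pi]
    intro i
    rw [differentiableAt_pi]
    exact hA i
  have e (i j : Fin n) : fderiv ℝ (fun w i j => A w i j) z v i j
      = fderiv ℝ (fun w => A w i j) z v := by
    rw [fderiv_pi (fun i => (differentiableAt_pi.1 hA') i)]
    simp only [ContinuousLinearMap.pi_apply]
    rw [fderiv_pi (hA i)]
    rfl
  have h1 := ((D.hasFDerivAt (A z)).comp z hA'.hasFDerivAt).fderiv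
  have h2 := congrArg (fun L => L v) h1
  change fderiv ℝ (fun w => (A w).det) z v = _ at h2
  rw [h2]
  refine (D.linearDeriv_apply (fun i j => A z i j) _).trans ?_
  refine Finset.sum_congr rfl fun i _ => ?_
  change ((A z).updateRow i _).det = _
  rw [← Matrix.cramer_transpose_apply, Matrix.cramer_eq_adjugate_mulVec, Matrix.mulVec,
    dotProduct]
  refine Finset.sum_congr rfl fun j _ => ?_
  rw [← Matrix.adjugate_transpose, Matrix.transpose_apply]
  exact congrArg _ (e i j)

/-- Both sides are `√det G · ½ tr(G⁻¹ ∂_k G)`: in the trace of the Christoffel symbols two of the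
three derivative terms cancel. It is what makes the weighted Laplacian a divergence. -/
lemma IsC2MetricAt.partialDeriv_sqrt_det (h : IsC2MetricAt G z) (hpos : 0 < (G z).det)
    (k : Fin n) : partialDeriv k (fun w => Real.sqrt (G w).det) z
      = Real.sqrt (G z).det * ∑ i, christoffel G i i k z := by
  have hd : DifferentiableAt ℝ (fun w => (G w).det) z :=
    (contDiffAt_det h.contDiffAt).differentiableAt (by norm_num)
  have hdiff : ∀ i j, DifferentiableAt ℝ (fun w => G w i j) z := fun i j =>
    (h.contDiffAt i j).differentiableAt (by norm_num)
  have hadj (i j : Fin n) : (G z).adjugate j i = (G z).det * (G z)⁻¹ j i := by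
    rw [Matrix.inv_def, Ring.inverse_eq_inv', Matrix.smul_apply, smul_eq_mul,
      mul_inv_cancel_left₀ h.det_ne]
  have hchr : ∑ i, christoffel G i i k z
      = (1 / 2) * ∑ i, ∑ j, (G z)⁻¹ j i * partialDeriv k (fun w => G w i j) z := by
    have e (a b c : Fin n) : partialDeriv a (fun w => G w b c) z
        = partialDeriv a (fun w => G w c b) z := by
      simp only [(h.symm _).apply b c]
    have : ∑ i, ∑ m, (G z)⁻¹ i m * partialDeriv i (fun w => G w k m) z
        = ∑ i, ∑ m, (G z)⁻¹ i m * partialDeriv m (fun w => G w i k) z := by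
      rw [Finset.sum_comm]
      refine Finset.sum_congr rfl fun i _ => Finset.sum_congr rfl fun m _ => ?_
      rw [h.inv_symm, e m]
    simp only [christoffel, ← Finset.mul_sum, mul_sub, mul_add, Finset.sum_add_distrib,
      Finset.sum_sub_distrib, this, h.inv_symm]
    ring_nf
  rw [hchr]
  simp only [partialDeriv]
  rw [(hd.hasFDerivAt.sqrt hpos.ne').fderiv, smul_apply, fderiv_det hdiff]
  simp only [hadj, mul_assoc, ← Finset.mul_sum, smul_eq_mul]
  have hs := Real.sqrt_pos.2 hpos
  field_simp
  rw [Real.sq_sqrt hpos.le]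

end CoordinateCurvature

end TotalScalar

namespace TotalScalar

section LocalNorms

variable {n : ℕ} {G : EuclideanSpace ℝ (Fin n) → Matrix (Fin n) (Fin n) ℝ}
  {z : EuclideanSpace ℝ (Fin n)} {u : EuclideanSpace ℝ (Fin n) → ℝ}

/-! #### Norms of `(u - 1) G` and of its covariant derivative -/

/-- The metric is parallel, so the covariant derivative only hits the scalar factor. -/
lemma covDerivCoeff_conformal (h : IsC2MetricAt G z) (hu : DifferentiableAt ℝ u z)
    (k i j : Fin n) : covDerivCoeff G (fun w => (u w - 1) • G w) k i j z
      = partialDeriv k u z * G z i j := by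
  have h1 : partialDeriv k (fun w => ((u w - 1) • G w) i j) z
      = (u z - 1) * partialDeriv k (fun w => G w i j) z + partialDeriv k u z * G z i j := by
    simp only [Matrix.smul_apply, smul_eq_mul, partialDeriv]
    rw [fderiv_fun_mul (hu.sub_const 1) ((h.contDiffAt i j).differentiableAt (by norm_num)),
      fderiv_sub_const]
    simp only [add_apply, smul_apply, smul_eq_mul]
    ring
  rw [covDerivCoeff, h1, h.partialDeriv_eq, Finset.mul_sum]
  simp only [Matrix.smul_apply, smul_eq_mul]
  rw [sub_eq_iff_eq_add, add_comm]
  congr 1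
  refine Finset.sum_congr rfl fun l _ => ?_
  ring

/-- This is `|g|_g² = n`, the source of the factor `n` in the two norm formulas that follow. -/
lemma IsC2MetricAt.contr_contr (h : IsC2MetricAt G z) :
    ∑ i, ∑ j, ∑ a, ∑ b, (G z)⁻¹ i a * (G z)⁻¹ j b * G z i j * G z a b = n := by
  have e (i j a : Fin n) : ∑ b, (G z)⁻¹ i a * (G z)⁻¹ j b * G z i j * G z a b
      = if a = j then (G z)⁻¹ i a * G z i j else 0 := by
    have := h.sum_mul_inv a j
    calc ∑ b, (G z)⁻¹ i a * (G z)⁻¹ j b * G z i j * G z a b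
        = (G z)⁻¹ i a * G z i j * ∑ b, G z a b * (G z)⁻¹ b j := by
          rw [Finset.mul_sum]
          refine Finset.sum_congr rfl fun b _ => ?_
          rw [h.inv_symm j b]
          ring
      _ = _ := by rw [this]; simp
  simp only [e, Finset.sum_ite_eq', Finset.mem_univ, if_true]
  have e' (i : Fin n) : ∑ j, (G z)⁻¹ i j * G z i j = 1 := by
    have := h.sum_mul_inv i i
    rw [if_pos rfl] at this
    rw [← this]
    refine Finset.sum_congr rfl fun j _ => ?_
    rw [h.inv_symm, mul_comm]
  simp [e']

lemma localTensorNormSq_conformal (h : IsC2MetricAt G z) :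
    localTensorNormSq G (fun w => (u w - 1) • G w) z = n * (u z - 1) ^ 2 := by
  rw [← h.contr_contr, localTensorNormSq]
  simp only [Matrix.smul_apply, smul_eq_mul, Finset.sum_mul]
  refine Finset.sum_congr rfl fun i _ => Finset.sum_congr rfl fun j _ =>
    Finset.sum_congr rfl fun a _ => Finset.sum_congr rfl fun b _ => ?_
  ring

lemma localCovDerivNormSq_conformal (h : IsC2MetricAt G z) (hu : DifferentiableAt ℝ u z) :
    localCovDerivNormSq G (fun w => (u w - 1) • G w) z = n * localGradSq G u z := by
  rw [localCovDerivNormSq]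
  simp only [covDerivCoeff_conformal h hu]
  have e (k c : Fin n) : ∑ i, ∑ j, ∑ a, ∑ b, (G z)⁻¹ k c * (G z)⁻¹ i a * (G z)⁻¹ j b
      * (partialDeriv k u z * G z i j) * (partialDeriv c u z * G z a b)
      = n * ((G z)⁻¹ k c * (partialDeriv k u z * partialDeriv c u z)) := by
    rw [← h.contr_contr]
    simp only [Finset.sum_mul]
    refine Finset.sum_congr rfl fun i _ => Finset.sum_congr rfl fun j _ =>
      Finset.sum_congr rfl fun a _ => Finset.sum_congr rfl fun b _ => ?_
    ring
  -- Moving the sum over `c` outwards exposes the fourfold contraction of `contr_contr`.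
  have e' (k : Fin n) : ∑ i, ∑ j, ∑ c, ∑ a, ∑ b, (G z)⁻¹ k c * (G z)⁻¹ i a * (G z)⁻¹ j b
      * (partialDeriv k u z * G z i j) * (partialDeriv c u z * G z a b)
      = ∑ c, ∑ i, ∑ j, ∑ a, ∑ b, (G z)⁻¹ k c * (G z)⁻¹ i a * (G z)⁻¹ j b
      * (partialDeriv k u z * G z i j) * (partialDeriv c u z * G z a b) :=
    (Finset.sum_congr rfl fun i _ => Finset.sum_comm).trans Finset.sum_comm
  simp only [e', e, localGradSq, Finset.mul_sum]

lemma localGradSq_transform {G' : EuclideanSpace ℝ (Fin n) → Matrix (Fin n) (Fin n) ℝ}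
    {τ : EuclideanSpace ℝ (Fin n) → EuclideanSpace ℝ (Fin n)}
    (hP : (stdMatrix (fderiv ℝ τ z)).det ≠ 0) (hτ : DifferentiableAt ℝ τ z)
    (hu : DifferentiableAt ℝ u (τ z))
    (hpull : G' z = (stdMatrix (fderiv ℝ τ z))ᵀ * G (τ z) * stdMatrix (fderiv ℝ τ z)) :
    localGradSq G' (u ∘ τ) z = localGradSq G u (τ z) := by
  let f : EuclideanSpace ℝ (Fin n) →ₗ[ℝ] EuclideanSpace ℝ (Fin n) →ₗ[ℝ] ℝ :=
    LinearMap.mk₂ ℝ (fun v w => fderiv ℝ u (τ z) v * fderiv ℝ u (τ z) w)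
      (by intros; simp; ring) (by intros; simp; ring) (by intros; simp; ring)
      (by intros; simp; ring)
  have := sum_inv_mul_congr (G (τ z)) _ (Matrix.of fun i j => f (stdE i) (stdE j)) hP
  rw [← bilinear_comp_matrix, ← hpull] at this
  simp only [localGradSq, partialDeriv, fderiv_comp _ hu hτ]
  exact this

lemma posDef_matrixBilin (hG : (G z).PosDef) (v : EuclideanSpace ℝ (Fin n)) :
    0 ≤ matrixBilin (G z) v v := by
  have := hG.posSemidef.dotProduct_mulVec_nonneg v.ofLp
  rw [matrixBilin_apply]
  simp only [dotProduct, Matrix.mulVec, Finset.mul_sum] at this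
  refine this.trans_eq ?_
  refine Finset.sum_congr rfl fun i _ => Finset.sum_congr rfl fun j _ => ?_
  simp
  ring

/-- Cauchy-Schwarz: a partial derivative is bounded by the norm of the differential. -/
lemma sq_partialDeriv_le (h : IsC2MetricAt G z) (hG : (G z).PosDef)
    (u : EuclideanSpace ℝ (Fin n) → ℝ) (k : Fin n) :
    (partialDeriv k u z) ^ 2 ≤ localGradSq G u z * G z k k := by
  -- `∂_k u` is the inner product of the gradient with `e_k`, and the gradient has squared norm
  -- `|du|²`.
  have h1 := matrixBilin_localGrad h u (stdE k)
  have h2 := matrixBilin_localGrad h u (localGrad G u z)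
  rw [fderiv_localGrad] at h2
  let f : LinearMap.BilinForm ℝ (EuclideanSpace ℝ (Fin n)) :=
    LinearMap.mk₂ ℝ (fun v w => matrixBilin (G z) v w) (by simp) (by simp) (by simp) (by simp)
  have := LinearMap.BilinForm.apply_sq_le_of_symm f (fun v => posDef_matrixBilin hG v)
    ⟨fun v w => h.bilin_symm z v w⟩ (localGrad G u z) (stdE k)
  simp only [f, LinearMap.mk₂_apply, h1, h2, matrixBilin_stdE] at this
  exact this

lemma localGradSq_nonneg (h : IsC2MetricAt G z) (hG : (G z).PosDef)
    (u : EuclideanSpace ℝ (Fin n) → ℝ) : 0 ≤ localGradSq G u z := by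
  rw [← fderiv_localGrad, ← matrixBilin_localGrad h]
  exact posDef_matrixBilin hG _

lemma IsC2MetricAt.continuousAt_localScalarCurvature (h : IsC2MetricAt G z) :
    ContinuousAt (localScalarCurvature G) z := by
  have hc (l i j : Fin n) : ContinuousAt (christoffel G l i j) z :=
    (h.contDiffAt_christoffel l i j).continuousAt
  have hd (k l i j : Fin n) : ContinuousAt (partialDeriv k (christoffel G l i j)) z :=
    ((h.contDiffAt_christoffel l i j).fderiv_right (m := 0) (by norm_num)).continuousAt.clm_apply
      continuousAt_const
  have hi (i j : Fin n) : ContinuousAt (fun w => (G w)⁻¹ i j) z :=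
    (contDiffAt_inv h.contDiffAt h.det_ne i j).continuousAt
  unfold localScalarCurvature ricciCoeff riemannCoeff
  fun_prop

end LocalNorms

end TotalScalar

namespace TotalScalar

section LocalLimit

variable {n : ℕ}

/-! #### Integration against a cutoff function -/

/-- Metric coefficients are regular only inside the image of a chart. For expressions carrying a
cutoff `a`, regularity on `tsupport a` is enough. -/
lemma continuous_of_eq_zero_off_tsupport {E : Type*} [TopologicalSpace E] {a f : E → ℝ}
    (hf : ∀ x ∈ tsupport a, ContinuousAt f x) (h0 : ∀ x ∉ tsupport a, f x = 0) :
    Continuous f := by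
  refine continuous_of_tsupport fun x hx => hf x ?_
  refine closure_minimal (fun y hy => ?_) (isClosed_tsupport a) hx
  by_contra h
  exact hy (h0 y h)

lemma integrable_of_eq_zero_off_tsupport {E : Type*} [TopologicalSpace E] [R1Space E]
    [MeasurableSpace E]
    [OpensMeasurableSpace E] {μ : Measure E} [IsFiniteMeasureOnCompacts μ] {a f : E → ℝ}
    (ha : HasCompactSupport a) (hf : ∀ x ∈ tsupport a, ContinuousAt f x)
    (h0 : ∀ x ∉ tsupport a, f x = 0) : Integrable f μ :=
  (continuous_of_eq_zero_off_tsupport hf h0).integrable_of_hasCompactSupport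
    (HasCompactSupport.intro ha h0)

/-- Integration by parts against a compactly supported function, the other factor being regular
only near the support. -/
lemma integral_mul_partialDeriv {a b f : EuclideanSpace ℝ (Fin n) → ℝ}
    (ha : ContDiff ℝ 1 a) (hac : HasCompactSupport a)
    (hb : ∀ x ∈ tsupport a, ContDiffAt ℝ 1 b x) (hf : ∀ x ∈ tsupport a, ContDiffAt ℝ 1 f x)
    (k : Fin n) :
    ∫ x, a x * b x * partialDeriv k f x
      = - ∫ x, (partialDeriv k a x * b x + a x * partialDeriv k b x) * f x := by
  have hpd {g : EuclideanSpace ℝ (Fin n) → ℝ} {x} (hg : ContDiffAt ℝ 1 g x) :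
      ContinuousAt (partialDeriv k g) x :=
    (hg.fderiv_right (m := 0) (by norm_num)).continuousAt.clm_apply continuousAt_const
  have ha0 {x} (hx : x ∉ tsupport a) : a x = 0 := image_eq_zero_of_notMem_tsupport hx
  have hev {x} (hx : x ∉ tsupport a) : a =ᶠ[𝓝 x] 0 := notMem_tsupport_iff_eventuallyEq.1 hx
  have hda {x} (hx : x ∉ tsupport a) : partialDeriv k a x = 0 := by
    simp [partialDeriv, (hev hx).fderiv_eq]
  have hdiff (x) : DifferentiableAt ℝ (fun x => a x * b x) x := by
    by_cases hx : x ∈ tsupport a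
    · exact (ha.contDiffAt.differentiableAt (by norm_num)).mul
        ((hb x hx).differentiableAt (by norm_num))
    · have : (fun x => a x * b x) =ᶠ[𝓝 x] fun _ => 0 := by
        filter_upwards [hev hx] with y hy
        simp [hy]
      exact (differentiableAt_const (0 : ℝ)).congr_of_eventuallyEq this
  -- Off the support both `a` and its derivative vanish, so the values of `b` and of its derivative
  -- there do not matter.
  have hd (x) : fderiv ℝ (fun x => a x * b x) x (EuclideanSpace.single k 1)
      = partialDeriv k a x * b x + a x * partialDeriv k b x := by
    by_cases hx : x ∈ tsupport a
    · rw [fderiv_fun_mul (ha.contDiffAt.differentiableAt (by norm_num))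
        ((hb x hx).differentiableAt (by norm_num))]
      simp only [add_apply, smul_apply, smul_eq_mul, partialDeriv]
      ring
    · have : (fun x => a x * b x) =ᶠ[𝓝 x] fun _ => 0 := by
        filter_upwards [hev hx] with y hy
        simp [hy]
      rw [this.fderiv_eq, hda hx, ha0 hx]
      simp
  have hts : tsupport (fun x => a x * b x) ⊆ tsupport a := tsupport_mul_subset_left
  have := integral_mul_fderiv_eq_neg_fderiv_mul_of_integrable (𝕜 := ℝ)
    (μ := (volume : Measure (EuclideanSpace ℝ (Fin n))))
    (f := fun x => a x * b x) (g := f) (v := EuclideanSpace.single k 1) ?_ ?_ ?_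
    (fun x _ => hdiff x) (fun x hx => (hf x (hts hx)).differentiableAt (by norm_num))
  · simpa only [hd, partialDeriv] using this
  · simp only [hd]
    refine integrable_of_eq_zero_off_tsupport hac (fun x hx => ?_) fun x hx => ?_
    · have h1 := hpd (ha.contDiffAt (x := x))
      have h2 := hpd (hb x hx)
      have h3 := (hb x hx).continuousAt
      have h4 := (hf x hx).continuousAt
      have h5 := ha.continuous.continuousAt (x := x)
      fun_prop
    · simp [ha0 hx, hda hx]
  · refine integrable_of_eq_zero_off_tsupport hac (fun x hx => ?_) fun x hx => ?_
    · have h2 : ContinuousAt (fun x => fderiv ℝ f x (EuclideanSpace.single k 1)) x := hpd (hf x hx)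
      have h3 := (hb x hx).continuousAt
      have h5 := ha.continuous.continuousAt (x := x)
      exact (h5.mul h3).mul h2
    · simp [ha0 hx]
  · refine integrable_of_eq_zero_off_tsupport hac (fun x hx => ?_) fun x hx => ?_
    · have h3 := (hb x hx).continuousAt
      have h4 := (hf x hx).continuousAt
      have h5 := ha.continuous.continuousAt (x := x)
      fun_prop
    · simp [ha0 hx]

/-- A dominated convergence argument: `∫ Φ(z, φ_i(z), p_i(z)) → ∫ Φ(z, 0, 0)`. -/
lemma tendsto_integral_of_continuousOn {a : EuclideanSpace ℝ (Fin n) → ℝ}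
    (hac : HasCompactSupport a)
    {Φ : EuclideanSpace ℝ (Fin n) → ℝ → (Fin n → ℝ) → ℝ}
    (hΦ : ∀ z ∈ tsupport a, ∀ t p, ContinuousAt (fun q : EuclideanSpace ℝ (Fin n) × ℝ ×
      (Fin n → ℝ) => Φ q.1 q.2.1 q.2.2) (z, t, p))
    (h0 : ∀ z, ¬ 0 < a z → ∀ t p, Φ z t p = 0)
    {φ : ℕ → EuclideanSpace ℝ (Fin n) → ℝ} {p : ℕ → EuclideanSpace ℝ (Fin n) → Fin n → ℝ}
    (hφ : ∀ i, ∀ z ∈ tsupport a, ContinuousAt (φ i) z)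
    (hp : ∀ i, ∀ z ∈ tsupport a, ContinuousAt (p i) z)
    (hlim : ∀ᵐ z, 0 < a z → Tendsto (fun i => φ i z) atTop (𝓝 0)
      ∧ Tendsto (fun i => p i z) atTop (𝓝 0))
    (hbd : ∀ᶠ i in atTop, ∀ᵐ z, 0 < a z → |φ i z| ≤ 1 ∧ ‖p i z‖ ≤ 1) :
    Tendsto (fun i => ∫ z, Φ z (φ i z) (p i z)) atTop (𝓝 (∫ z, Φ z 0 0)) := by
  have hpos {z} (hz : 0 < a z) : z ∈ tsupport a := subset_tsupport _ hz.ne'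
  -- Eventually, almost everywhere on `0 < a`, the arguments of `Φ` lie in this compact set; the
  -- bound of `Φ` on it, restricted to the support, is the dominating function.
  have hK : IsCompact (tsupport a ×ˢ (Metric.closedBall (0 : ℝ) 1 ×ˢ
      Metric.closedBall (0 : Fin n → ℝ) 1)) :=
    IsCompact.prod hac ((isCompact_closedBall _ _).prod (isCompact_closedBall _ _))
  obtain ⟨C, hC⟩ := hK.exists_bound_of_continuousOn (f := fun q : EuclideanSpace ℝ (Fin n) × ℝ ×
      (Fin n → ℝ) => Φ q.1 q.2.1 q.2.2)
      (fun q hq => (hΦ q.1 hq.1 q.2.1 q.2.2).continuousWithinAt)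
  have hcont (i : ℕ) : Continuous fun z => Φ z (φ i z) (p i z) := by
    refine continuous_of_eq_zero_off_tsupport (a := a) (fun z hz => ?_) fun z hz => ?_
    · exact ContinuousAt.comp (f := fun z => (z, φ i z, p i z)) (hΦ z hz _ _)
        (continuousAt_id.prodMk ((hφ i z hz).prodMk (hp i z hz)))
    · exact h0 z (fun h => hz (hpos h)) _ _
  refine tendsto_integral_filter_of_dominated_convergence
    ((tsupport a).indicator fun _ => C) ?_ ?_ ?_ ?_
  · exact .of_forall fun i => (hcont i).aestronglyMeasurable
  · filter_upwards [hbd] with i hi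
    filter_upwards [hi] with z hz
    by_cases hza : 0 < a z
    · rw [Set.indicator_of_mem (hpos hza)]
      exact hC (z, φ i z, p i z) ⟨hpos hza, by simpa using (hz hza).1, by simpa using (hz hza).2⟩
    · rw [h0 z hza, norm_zero]
      by_cases hzt : z ∈ tsupport a
      · rw [Set.indicator_of_mem hzt]
        -- Only `0 ≤ C` is needed here, and it follows from the bound at any point of the compact
        -- set.
        exact (norm_nonneg _).trans (hC (z, 0, 0) ⟨hzt, by simp, by simp⟩)
      · rw [Set.indicator_of_notMem hzt]
  · rw [integrable_indicator_iff (isClosed_tsupport a).measurableSet]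
    exact integrableOn_const (IsCompact.measure_lt_top hac).ne
  · filter_upwards [hlim] with z hz
    by_cases hza : 0 < a z
    · have := (hΦ z (hpos hza) 0 0).tendsto.comp
        (tendsto_const_nhds.prodMk_nhds ((hz hza).1.prodMk_nhds (hz hza).2))
      exact this
    · simp [h0 z hza]

/-! #### Convergence of the total scalar curvature in a chart -/

/-- `|p|²` for a covector `p`. -/
def covecSq (A : Matrix (Fin n) (Fin n) ℝ) (p : Fin n → ℝ) : ℝ :=
  ∑ j, ∑ k, A⁻¹ j k * (p j * p k)

variable {G : EuclideanSpace ℝ (Fin n) → Matrix (Fin n) (Fin n) ℝ}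
  {a : EuclideanSpace ℝ (Fin n) → ℝ}

/-- `√det G` times the Laplacian is a divergence. -/
lemma sqrt_det_mul_localLaplacian {z : EuclideanSpace ℝ (Fin n)}
    {φ : EuclideanSpace ℝ (Fin n) → ℝ} (h : IsC2MetricAt G z) (hpos : 0 < (G z).det)
    (hφ : ContDiffAt ℝ 2 φ z) :
    Real.sqrt (G z).det * localLaplacian G φ z
      = ∑ l, partialDeriv l (fun w => Real.sqrt (G w).det * localGrad G φ w l) z := by
  have hN : DifferentiableAt ℝ (localGrad G φ) z :=
    (contDiffAt_localGrad h hφ).differentiableAt (by norm_num)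
  have hs : DifferentiableAt ℝ (fun w => Real.sqrt (G w).det) z :=
    ((contDiffAt_det h.contDiffAt).differentiableAt (by norm_num)).sqrt hpos.ne'
  have hNl (l : Fin n) : HasFDerivAt (fun w => localGrad G φ w l)
      ((EuclideanSpace.proj (𝕜 := ℝ) l).comp (fderiv ℝ (localGrad G φ) z)) z :=
    (EuclideanSpace.proj (𝕜 := ℝ) l).hasFDerivAt.comp z hN.hasFDerivAt
  have e (l : Fin n) : partialDeriv l (fun w => Real.sqrt (G w).det * localGrad G φ w l) z
      = Real.sqrt (G z).det * (fderiv ℝ (localGrad G φ) z (stdE l) l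
        + localGrad G φ z l * ∑ i, christoffel G i i l z) := by
    have h1 := h.partialDeriv_sqrt_det hpos l
    rw [partialDeriv] at h1 ⊢
    rw [fderiv_fun_mul hs (hNl l).differentiableAt, (hNl l).fderiv]
    simp only [add_apply, smul_apply, smul_eq_mul, h1, ContinuousLinearMap.comp_apply]
    change _ * (fderiv ℝ (localGrad G φ) z (stdE l) l) + _ = _
    ring
  simp only [e, ← Finset.mul_sum, Finset.sum_add_distrib]
  congr 1
  simp only [localLaplacian, localHess, add_apply, PiLp.add_apply, Finset.sum_add_distrib,
    ContinuousLinearMap.flip_apply]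
  congr 1
  -- The connection part of the Laplacian is the same trace of Christoffel symbols that arises from
  -- differentiating `√det G`.
  have : ∀ i, christoffelMap G z (stdE i) (localGrad G φ z) i
      = ∑ l, localGrad G φ z l * christoffel G i i l z := by
    intro i
    simp [christoffelMap_apply, mul_comm]
  simp only [this, Finset.mul_sum]
  rw [Finset.sum_comm]

lemma sqrt_det_exp_smul (A : Matrix (Fin n) (Fin n) ℝ) (t : ℝ) :
    Real.sqrt (Real.exp t • A).det = Real.exp (n / 2 * t) * Real.sqrt A.det := by
  rw [Matrix.det_smul, Real.sqrt_mul (by positivity), ← Real.exp_nat_mul, Fintype.card_fin,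
    Real.sqrt_eq_rpow, ← Real.exp_mul]
  congr 2
  ring

/-- The integrand of the total scalar curvature of `exp φ • G` after integration by parts, as a
function of the point, of `φ` and of its differential. -/
def totalIntegrand (G : EuclideanSpace ℝ (Fin n) → Matrix (Fin n) (Fin n) ℝ)
    (a : EuclideanSpace ℝ (Fin n) → ℝ) (z : EuclideanSpace ℝ (Fin n)) (t : ℝ) (p : Fin n → ℝ) :
    ℝ :=
  Real.exp ((n / 2 - 1) * t) * Real.sqrt (G z).det *
    (a z * (localScalarCurvature G z - (n - 1) * (n - 2) / 4 * covecSq (G z) p)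
      + (n - 1) * (∑ l, (partialDeriv l a z + a z * ((n / 2 - 1) * p l)) *
        ∑ m, (G z)⁻¹ l m * p m))

/-- The only second derivatives of `φ` sit in `√det G · Δφ`, a divergence. Integration by parts
moves that derivative onto `a · exp((n/2 - 1) φ)`, leaving an integrand in `φ` and `dφ`. -/
lemma integral_scalarCurvature_conformal {φ : EuclideanSpace ℝ (Fin n) → ℝ}
    (ha : ContDiff ℝ 1 a) (hac : HasCompactSupport a)
    (hG : ∀ z ∈ tsupport a, IsC2MetricAt G z) (hdet : ∀ z ∈ tsupport a, 0 < (G z).det)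
    (hφ : ∀ z ∈ tsupport a, ContDiffAt ℝ 2 φ z) :
    ∫ z, a z * (localScalarCurvature (fun w => Real.exp (φ w) • G w) z
        * Real.sqrt (Real.exp (φ z) • G z).det)
      = ∫ z, totalIntegrand G a z (φ z) (fun k => partialDeriv k φ z) := by
  -- In the exponent, `n/2` comes from the volume density and `-1` from the scalar curvature.
  set b : EuclideanSpace ℝ (Fin n) → ℝ := fun z => Real.exp ((n / 2 - 1) * φ z) with hbdef
  have ha0 {x} (hx : x ∉ tsupport a) : a x = 0 := image_eq_zero_of_notMem_tsupport hx
  have hda {x} (hx : x ∉ tsupport a) (k : Fin n) : partialDeriv k a x = 0 := by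
    simp [partialDeriv, (notMem_tsupport_iff_eventuallyEq.1 hx).fderiv_eq]
  have hpd (k : Fin n) {g : EuclideanSpace ℝ (Fin n) → ℝ} {x} (hg : ContDiffAt ℝ 1 g x) :
      ContinuousAt (partialDeriv k g) x :=
    (hg.fderiv_right (m := 0) (by norm_num)).continuousAt.clm_apply continuousAt_const
  have hb : ∀ z ∈ tsupport a, ContDiffAt ℝ 1 b z := fun z hz =>
    (contDiffAt_const.mul ((hφ z hz).of_le (by norm_num))).exp
  have hs : ∀ z ∈ tsupport a, ContDiffAt ℝ 1 (fun w => Real.sqrt (G w).det) z := fun z hz =>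
    ((contDiffAt_det (hG z hz).contDiffAt).sqrt (hdet z hz).ne').of_le (by norm_num)
  have hN (l : Fin n) : ∀ z ∈ tsupport a, ContDiffAt ℝ 1 (fun w => localGrad G φ w l) z :=
    fun z hz => (EuclideanSpace.proj (𝕜 := ℝ) l).contDiff.contDiffAt.comp z
      (contDiffAt_localGrad (hG z hz) (hφ z hz))
  have hf (l : Fin n) : ∀ z ∈ tsupport a,
      ContDiffAt ℝ 1 (fun w => Real.sqrt (G w).det * localGrad G φ w l) z :=
    fun z hz => (hs z hz).mul (hN l z hz)
  have hdb (l : Fin n) : ∀ z ∈ tsupport a, partialDeriv l b z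
      = (n / 2 - 1) * partialDeriv l φ z * b z := by
    intro z hz
    have hd := (hφ z hz).differentiableAt (by norm_num)
    rw [partialDeriv, ((hd.hasFDerivAt.const_mul ((n : ℝ) / 2 - 1)).exp).fderiv]
    simp only [smul_apply, smul_eq_mul, partialDeriv, hbdef]
    ring
  have e1 (z) : a z * (localScalarCurvature (fun w => Real.exp (φ w) • G w) z
        * Real.sqrt (Real.exp (φ z) • G z).det)
      = b z * Real.sqrt (G z).det * (a z * (localScalarCurvature G z
          - (n - 1) * (n - 2) / 4 * localGradSq G φ z))
        + ∑ l, (-(n - 1 : ℝ)) * (a z * b z * partialDeriv l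
          (fun w => Real.sqrt (G w).det * localGrad G φ w l) z) := by
    by_cases hz : z ∈ tsupport a
    · rw [← Finset.mul_sum, ← Finset.mul_sum,
        ← sqrt_det_mul_localLaplacian (hG z hz) (hdet z hz) (hφ z hz),
        localScalarCurvature_conformal (hG z hz) (hφ z hz), sqrt_det_exp_smul, hbdef]
      have : Real.exp ((n / 2 - 1) * φ z) = Real.exp (-φ z) * Real.exp (n / 2 * φ z) := by
        rw [← Real.exp_add]
        congr 1
        ring
      simp only [this]
      ring
    · simp [ha0 hz]
  have e2 (z) : totalIntegrand G a z (φ z) (fun k => partialDeriv k φ z)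
      = b z * Real.sqrt (G z).det * (a z * (localScalarCurvature G z
          - (n - 1) * (n - 2) / 4 * localGradSq G φ z))
        + ∑ l, (n - 1 : ℝ) * ((partialDeriv l a z * b z + a z * partialDeriv l b z)
          * (Real.sqrt (G z).det * localGrad G φ z l)) := by
    by_cases hz : z ∈ tsupport a
    · have : ∀ l, (n - 1 : ℝ) * ((partialDeriv l a z * b z + a z * partialDeriv l b z)
          * (Real.sqrt (G z).det * localGrad G φ z l))
          = b z * Real.sqrt (G z).det * ((n - 1) * ((partialDeriv l a z
            + a z * ((n / 2 - 1) * partialDeriv l φ z)) *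
              ∑ m, (G z)⁻¹ l m * partialDeriv m φ z)) := by
        intro l
        rw [hdb l z hz, localGrad_apply]
        ring
      rw [Finset.sum_congr rfl fun l _ => this l, ← Finset.mul_sum, ← Finset.mul_sum,
        totalIntegrand, localGradSq, covecSq]
      ring
    · simp [totalIntegrand, ha0 hz, hda hz]
  have i1 : Integrable fun z => b z * Real.sqrt (G z).det * (a z * (localScalarCurvature G z
      - (n - 1) * (n - 2) / 4 * localGradSq G φ z)) := by
    refine integrable_of_eq_zero_off_tsupport hac (fun z hz => ?_) fun z hz => by simp [ha0 hz]
    have h1 := (hb z hz).continuousAt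
    have h2 := (hs z hz).continuousAt
    have h3 := ha.continuous.continuousAt (x := z)
    have h4 := (hG z hz).continuousAt_localScalarCurvature
    have h5 : ContinuousAt (localGradSq G φ) z := by
      have hi (i j : Fin n) : ContinuousAt (fun w => (G w)⁻¹ i j) z :=
        (contDiffAt_inv (hG z hz).contDiffAt (hG z hz).det_ne i j).continuousAt
      have hp (k : Fin n) := hpd k ((hφ z hz).of_le (m := 1) (by norm_num))
      unfold localGradSq
      fun_prop
    fun_prop
  have i2 (l : Fin n) : Integrable fun z => a z * b z * partialDeriv l
      (fun w => Real.sqrt (G w).det * localGrad G φ w l) z := by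
    refine integrable_of_eq_zero_off_tsupport hac (fun z hz => ?_) fun z hz => by simp [ha0 hz]
    exact (ha.continuous.continuousAt.mul (hb z hz).continuousAt).mul (hpd l (hf l z hz))
  have i3 (l : Fin n) : Integrable fun z => (partialDeriv l a z * b z + a z * partialDeriv l b z)
      * (Real.sqrt (G z).det * localGrad G φ z l) := by
    refine integrable_of_eq_zero_off_tsupport hac (fun z hz => ?_)
      fun z hz => by simp [ha0 hz, hda hz]
    exact (((hpd l ha.contDiffAt).mul (hb z hz).continuousAt).add
      (ha.continuous.continuousAt.mul (hpd l (hb z hz)))).mul (hf l z hz).continuousAt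
  simp only [e1, e2]
  rw [integral_add i1 (integrable_finsetSum _ fun l _ => (i2 l).const_mul _),
    integral_add i1 (integrable_finsetSum _ fun l _ => (i3 l).const_mul _),
    integral_finsetSum _ fun l _ => (i2 l).const_mul _,
    integral_finsetSum _ fun l _ => (i3 l).const_mul _]
  congr 1
  refine Finset.sum_congr rfl fun l _ => ?_
  rw [integral_const_mul, integral_const_mul, integral_mul_partialDeriv ha hac hb (hf l) l]
  ring

/-- Convergence of the localized total scalar curvatures of conformal metrics. -/
lemma tendsto_integral_scalarCurvature_conformal
    (ha : ContDiff ℝ 1 a) (hac : HasCompactSupport a) (hnn : ∀ z, 0 ≤ a z)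
    (hG : ∀ z ∈ tsupport a, IsC2MetricAt G z) (hdet : ∀ z ∈ tsupport a, 0 < (G z).det)
    {φ : ℕ → EuclideanSpace ℝ (Fin n) → ℝ}
    (hφ : ∀ i, ∀ z ∈ tsupport a, ContDiffAt ℝ 2 (φ i) z)
    (hlim : ∀ᵐ z, 0 < a z → Tendsto (fun i => φ i z) atTop (𝓝 0)
      ∧ ∀ k, Tendsto (fun i => partialDeriv k (φ i) z) atTop (𝓝 0))
    (hbd : ∀ᶠ i in atTop, ∀ᵐ z, 0 < a z → |φ i z| ≤ 1 ∧ ∀ k, |partialDeriv k (φ i) z| ≤ 1) :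
    Tendsto (fun i => ∫ z, a z * (localScalarCurvature (fun w => Real.exp (φ i w) • G w) z
        * Real.sqrt (Real.exp (φ i z) • G z).det)) atTop
      (𝓝 (∫ z, a z * (localScalarCurvature G z * Real.sqrt (G z).det))) := by
  have hpd (k : Fin n) {g : EuclideanSpace ℝ (Fin n) → ℝ} {x} (hg : ContDiffAt ℝ 1 g x) :
      ContinuousAt (partialDeriv k g) x :=
    (hg.fderiv_right (m := 0) (by norm_num)).continuousAt.clm_apply continuousAt_const
  -- At `φ = 0`, `dφ = 0` the integrand is the scalar curvature density of `G` itself, so the limit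
  -- needs no integration by parts.
  have hlimit : ∫ z, a z * (localScalarCurvature G z * Real.sqrt (G z).det)
      = ∫ z, totalIntegrand G a z 0 0 := by
    congr 1
    ext z
    simp [totalIntegrand, covecSq]
    ring
  rw [hlimit]
  simp only [fun i => integral_scalarCurvature_conformal ha hac hG hdet (hφ i)]
  refine tendsto_integral_of_continuousOn (a := a) hac (fun z hz t p => ?_) (fun z hz t p => ?_)
    (fun i z hz => (hφ i z hz).continuousAt)
    (fun i z hz => continuousAt_pi.2 fun k => hpd k ((hφ i z hz).of_le (by norm_num))) ?_ ?_
  · have h2 : ContinuousAt (fun q : EuclideanSpace ℝ (Fin n) × ℝ × (Fin n → ℝ) =>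
        (G q.1).det) (z, t, p) :=
      ContinuousAt.comp (g := fun w => (G w).det) (f := Prod.fst)
        (contDiffAt_det (hG z hz).contDiffAt).continuousAt continuousAt_fst
    have h3 : ContinuousAt (fun q : EuclideanSpace ℝ (Fin n) × ℝ × (Fin n → ℝ) => a q.1)
        (z, t, p) := ha.continuous.continuousAt.comp continuousAt_fst
    have h4 : ContinuousAt (fun q : EuclideanSpace ℝ (Fin n) × ℝ × (Fin n → ℝ) =>
        localScalarCurvature G q.1) (z, t, p) :=
      ContinuousAt.comp (g := localScalarCurvature G) (f := Prod.fst)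
        (hG z hz).continuousAt_localScalarCurvature
        continuousAt_fst
    have hi (i j : Fin n) : ContinuousAt (fun q : EuclideanSpace ℝ (Fin n) × ℝ × (Fin n → ℝ) =>
        (G q.1)⁻¹ i j) (z, t, p) :=
      ContinuousAt.comp (g := fun w => (G w)⁻¹ i j) (f := Prod.fst)
        (contDiffAt_inv (hG z hz).contDiffAt (hG z hz).det_ne i j).continuousAt continuousAt_fst
    have h5 (l : Fin n) : ContinuousAt (fun q : EuclideanSpace ℝ (Fin n) × ℝ × (Fin n → ℝ) =>
        partialDeriv l a q.1) (z, t, p) :=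
      ContinuousAt.comp (g := partialDeriv l a) (f := Prod.fst) (hpd l ha.contDiffAt)
        continuousAt_fst
    have hp (j : Fin n) : ContinuousAt (fun q : EuclideanSpace ℝ (Fin n) × ℝ × (Fin n → ℝ) =>
        q.2.2 j) (z, t, p) := by fun_prop
    have ht : ContinuousAt (fun q : EuclideanSpace ℝ (Fin n) × ℝ × (Fin n → ℝ) =>
        Real.exp ((n / 2 - 1) * q.2.1)) (z, t, p) := by fun_prop
    have hc : ContinuousAt (fun q : EuclideanSpace ℝ (Fin n) × ℝ × (Fin n → ℝ) =>
        covecSq (G q.1) q.2.2) (z, t, p) := by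
      unfold covecSq
      exact tendsto_finsetSum _ fun j _ => tendsto_finsetSum _ fun k _ =>
        (hi j k).mul ((hp j).mul (hp k))
    unfold totalIntegrand
    refine (ht.mul h2.sqrt).mul ((h3.mul (h4.sub (hc.const_mul _))).add (ContinuousAt.const_mul
      (tendsto_finsetSum _ fun l _ => ?_) _))
    exact ((h5 l).add (h3.mul ((hp l).const_mul _))).mul
      (tendsto_finsetSum _ fun m _ => (hi l m).mul (hp m))
  -- A zero of `a ≥ 0` is a minimum, so `da` vanishes there too. Hence the term with `da`
  -- contributes nothing where `a` is not positive, which is where `φ` is not controlled.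
  · have haz : a z = 0 := le_antisymm (not_lt.1 hz) (hnn z)
    have hmin : IsLocalMin a z := .of_forall fun y => by rw [haz]; exact hnn y
    simp [totalIntegrand, haz, partialDeriv, hmin.fderiv_eq_zero]
  · filter_upwards [hlim] with z hz hza
    exact ⟨(hz hza).1, tendsto_pi_nhds.2 (hz hza).2⟩
  · filter_upwards [hbd] with i hi
    filter_upwards [hi] with z hz hza
    exact ⟨(hz hza).1, (pi_norm_le_iff_of_nonneg zero_le_one).2 (hz hza).2⟩

end LocalLimit

end TotalScalar

namespace TotalScalar

section Charts

variable {n : ℕ} {M : Type*} [TopologicalSpace M] [ChartedSpace (EuclideanSpace ℝ (Fin n)) M]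

/-! ### Metrics in the preferred charts -/

lemma coordMatrix_smul_sub (u : M → ℝ) {h h' : BilinField n M}
    (hh : ∀ x, h' x = u x • h x) (c : M) :
    coordMatrix (fun x => h' x - h x) c
      = fun z => (u ((extChartAt (𝓡 n) c).symm z) - 1) • coordMatrix h c z := by
  ext z i j
  simp only [coordMatrix, Matrix.of_apply, hh, Matrix.smul_apply, smul_eq_mul, sub_mul, one_mul]
  rfl

lemma coordMatrix_smul (u : M → ℝ) {h h' : BilinField n M}
    (hh : ∀ x, h' x = u x • h x) (c : M) :
    coordMatrix h' c = fun z => u ((extChartAt (𝓡 n) c).symm z) • coordMatrix h c z := by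
  ext z i j
  simp only [coordMatrix, Matrix.of_apply, hh, Matrix.smul_apply, smul_eq_mul]
  rfl

/-- The derivative of the inverse of a chart. -/
def chartInvDeriv (c : M) (z : EuclideanSpace ℝ (Fin n)) :
    EuclideanSpace ℝ (Fin n) →L[ℝ] EuclideanSpace ℝ (Fin n) :=
  mfderiv (𝓡 n) (𝓡 n) (extChartAt (𝓡 n) c).symm z

/-- The bilinear form of a tensor field at a point, as a form on the model space. -/
def modelForm (h : BilinField n M) (p : M) :
    EuclideanSpace ℝ (Fin n) →ₗ[ℝ] EuclideanSpace ℝ (Fin n) →ₗ[ℝ] ℝ :=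
  LinearMap.mk₂ ℝ (fun v w => h p v w)
    (fun a b x => DFunLike.congr_fun ((h p).map_add a b) x)
    (fun a b x => DFunLike.congr_fun ((h p).map_smul a b) x)
    (fun a b x => (h p a).map_add b x) (fun a b x => (h p b).map_smul a x)

/-- Replaces tangent spaces by the model space, so that the linear algebra of `ℝⁿ` applies. -/
lemma coordMatrix_eq (h : BilinField n M) (c : M) (z : EuclideanSpace ℝ (Fin n)) :
    coordMatrix h c z = Matrix.of fun i j => modelForm h ((extChartAt (𝓡 n) c).symm z)
      (chartInvDeriv c z (stdE i)) (chartInvDeriv c z (stdE j)) := rfl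

/-- The transition map from the preferred chart at `x` to the preferred chart at `c`. -/
def transition (x c : M) : EuclideanSpace ℝ (Fin n) → EuclideanSpace ℝ (Fin n) :=
  extChartAt (𝓡 n) c ∘ (extChartAt (𝓡 n) x).symm

lemma transition_extChartAt {x c p : M} (hx : p ∈ (extChartAt (𝓡 n) x).source) :
    transition x c (extChartAt (𝓡 n) x p) = extChartAt (𝓡 n) c p := by
  rw [transition, Function.comp_apply, (extChartAt (𝓡 n) x).left_inv hx]

variable [IsManifold (𝓡 n) ∞ M]

lemma contMDiffAt_extChartAt_symm {c : M} {z : EuclideanSpace ℝ (Fin n)}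
    (hz : z ∈ (extChartAt (𝓡 n) c).target) :
    ContMDiffAt (𝓡 n) (𝓡 n) ∞ (extChartAt (𝓡 n) c).symm z :=
  (contMDiffOn_extChartAt_symm c).contMDiffAt ((isOpen_extChartAt_target c).mem_nhds hz)

lemma mdifferentiableAt_extChartAt_symm {c : M} {z : EuclideanSpace ℝ (Fin n)}
    (hz : z ∈ (extChartAt (𝓡 n) c).target) :
    MDifferentiableAt (𝓡 n) (𝓡 n) (extChartAt (𝓡 n) c).symm z :=
  (contMDiffAt_extChartAt_symm hz).mdifferentiableAt (by simp)

/-- The coordinate field is the tangent map of the inverse chart composed with a constant section.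
-/
lemma contMDiffAt_coordVec {c : M} {z : EuclideanSpace ℝ (Fin n)}
    (hz : z ∈ (extChartAt (𝓡 n) c).target) (i : Fin n) :
    ContMDiffAt (𝓡 n) (𝓡 n).tangent 2 (fun y => (⟨(extChartAt (𝓡 n) c).symm y, coordVec c y i⟩ :
      TangentBundle (𝓡 n) M)) z := by
  have hopen := isOpen_extChartAt_target (I := 𝓡 n) c
  have h1 : ContMDiffOn (𝓡 n).tangent (𝓡 n).tangent 2
      (tangentMapWithin (𝓡 n) (𝓡 n) (extChartAt (𝓡 n) c).symm (extChartAt (𝓡 n) c).target)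
      (Bundle.TotalSpace.proj ⁻¹' (extChartAt (𝓡 n) c).target) :=
    (contMDiffOn_extChartAt_symm (n := ∞) c).contMDiffOn_tangentMapWithin (by norm_cast)
      hopen.uniqueMDiffOn
  have h2 : ContMDiff (𝓡 n) (𝓡 n).tangent 2 (fun y : EuclideanSpace ℝ (Fin n) =>
      (⟨y, stdVec y i⟩ : TangentBundle (𝓡 n) (EuclideanSpace ℝ (Fin n)))) := by
    intro y
    rw [Bundle.contMDiffAt_section]
    simpa [stdVec] using contMDiffAt_const
  have h3 := h1.comp (s := (extChartAt (𝓡 n) c).target) h2.contMDiffOn (fun y hy => hy)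
  refine (h3.contMDiffAt (hopen.mem_nhds hz)).congr_of_eventuallyEq ?_
  filter_upwards [hopen.mem_nhds hz] with y hy
  simp only [Function.comp_apply, tangentMapWithin, coordVec]
  rw [mfderivWithin_of_isOpen hopen hy]

lemma contDiffAt_coordMatrix (g : C2Metric n M) {c : M} {z : EuclideanSpace ℝ (Fin n)}
    (hz : z ∈ (extChartAt (𝓡 n) c).target) (i j : Fin n) :
    ContDiffAt ℝ 2 (fun y => coordMatrix g.inner c y i j) z := by
  rw [← contMDiffAt_iff_contDiffAt]
  have h0 : ContMDiffAt (𝓡 n) (𝓡 n) 2 (extChartAt (𝓡 n) c).symm z :=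
    (contMDiffAt_extChartAt_symm hz).of_le (by norm_cast)
  have := ContMDiffAt.clm_bundle_apply₂ (E₃ := Bundle.Trivial M ℝ) (F₁ := EuclideanSpace ℝ (Fin n))
    (F₂ := EuclideanSpace ℝ (Fin n))
    ((g.contMDiff ((extChartAt (𝓡 n) c).symm z)).comp z h0)
    (contMDiffAt_coordVec hz i) (contMDiffAt_coordVec hz j)
  rw [Bundle.contMDiffAt_totalSpace] at this
  exact this.2

lemma chartInvDeriv_injective {c : M} {z : EuclideanSpace ℝ (Fin n)}
    (hz : z ∈ (extChartAt (𝓡 n) c).target) : Function.Injective (chartInvDeriv c z) := by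
  have := isInvertible_mfderivWithin_extChartAt_symm (I := 𝓡 n) hz
  rw [modelWithCornersSelf_coe, Set.range_id, mfderivWithin_univ] at this
  exact this.injective

lemma posDef_coordMatrix (g : C2Metric n M) {c : M} {z : EuclideanSpace ℝ (Fin n)}
    (hz : z ∈ (extChartAt (𝓡 n) c).target) : (coordMatrix g.inner c z).PosDef := by
  have hsymm : (coordMatrix g.inner c z).IsHermitian := by
    ext i j
    simp only [Matrix.conjTranspose_apply, star_trivial]
    exact g.symm _ _ _
  refine Matrix.PosDef.of_dotProduct_mulVec_pos hsymm fun x hx => ?_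
  have e : star x ⬝ᵥ coordMatrix g.inner c z *ᵥ x
      = modelForm g.inner ((extChartAt (𝓡 n) c).symm z) (chartInvDeriv c z (WithLp.toLp 2 x))
        (chartInvDeriv c z (WithLp.toLp 2 x)) := by
    rw [eq_sum_stdE (WithLp.toLp 2 x)]
    simp only [map_sum, map_smul, LinearMap.sum_apply, LinearMap.smul_apply, smul_eq_mul,
      dotProduct, Matrix.mulVec, Finset.mul_sum, coordMatrix_eq, Matrix.of_apply, star_trivial,
      Pi.star_apply]
    rw [Finset.sum_comm]
    refine Finset.sum_congr rfl fun a _ => Finset.sum_congr rfl fun b _ => ?_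
    ring
  rw [e]
  -- Positivity transfers because the inverse chart has injective derivative.
  refine g.pos _ _ fun h0 => hx ?_
  have : chartInvDeriv c z (WithLp.toLp 2 x) = chartInvDeriv c z 0 := by
    rw [map_zero]
    exact h0
  have := chartInvDeriv_injective hz this
  simpa using this

lemma isC2MetricAt_coordMatrix (g : C2Metric n M) {c : M} {z : EuclideanSpace ℝ (Fin n)}
    (hz : z ∈ (extChartAt (𝓡 n) c).target) : IsC2MetricAt (coordMatrix g.inner c) z where
  contDiffAt := contDiffAt_coordMatrix g hz
  symm w := by
    ext i j
    exact g.symm _ _ _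
  det_ne := (posDef_coordMatrix g hz).det_pos.ne'

/-! #### Transition maps -/

lemma eventually_mem_overlap {x c p : M} (hx : p ∈ (extChartAt (𝓡 n) x).source)
    (hc : p ∈ (extChartAt (𝓡 n) c).source) :
    ∀ᶠ y in 𝓝 (extChartAt (𝓡 n) x p), y ∈ (extChartAt (𝓡 n) x).target ∧
      (extChartAt (𝓡 n) x).symm y ∈ (extChartAt (𝓡 n) c).source := by
  have hz := (extChartAt (𝓡 n) x).map_source hx
  refine ((isOpen_extChartAt_target x).eventually_mem hz).and ?_
  refine (contMDiffAt_extChartAt_symm hz).continuousAt.eventually_mem ?_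
  rw [(extChartAt (𝓡 n) x).left_inv hx]
  exact (isOpen_extChartAt_source c).mem_nhds hc

lemma contDiffAt_transition {x c : M} {y : EuclideanSpace ℝ (Fin n)}
    (hy : y ∈ (extChartAt (𝓡 n) x).target)
    (hc : (extChartAt (𝓡 n) x).symm y ∈ (extChartAt (𝓡 n) c).source) :
    ContDiffAt ℝ ∞ (transition x c) y := by
  have := contDiffWithinAt_ext_coord_change (I := 𝓡 n) (n := ∞) c x (y := y) (by
    rw [PartialEquiv.trans_source]
    exact ⟨hy, hc⟩)
  rwa [modelWithCornersSelf_coe, Set.range_id, contDiffWithinAt_univ] at this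

/-- Chain rule for the inverse chart at `x`, which near `y` is the inverse chart at `c` after the
transition map. -/
lemma coordMatrix_transition (h : BilinField n M) {x c : M} {y : EuclideanSpace ℝ (Fin n)}
    (hev : ∀ᶠ y in 𝓝 y, y ∈ (extChartAt (𝓡 n) x).target ∧
      (extChartAt (𝓡 n) x).symm y ∈ (extChartAt (𝓡 n) c).source) :
    coordMatrix h x y = (stdMatrix (fderiv ℝ (transition x c) y))ᵀ
      * coordMatrix h c (transition x c y) * stdMatrix (fderiv ℝ (transition x c) y) := by
  obtain ⟨hy, hc⟩ := hev.self_of_nhds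
  have hτ : transition x c y ∈ (extChartAt (𝓡 n) c).target := (extChartAt (𝓡 n) c).map_source hc
  have hinv {y} (hc : (extChartAt (𝓡 n) x).symm y ∈ (extChartAt (𝓡 n) c).source) :
      (extChartAt (𝓡 n) c).symm (transition x c y) = (extChartAt (𝓡 n) x).symm y :=
    (extChartAt (𝓡 n) c).left_inv hc
  have e : (extChartAt (𝓡 n) x).symm =ᶠ[𝓝 y] (extChartAt (𝓡 n) c).symm ∘ transition x c := by
    filter_upwards [hev] with w hw using (hinv hw.2).symm
  have hd : chartInvDeriv x y
      = (chartInvDeriv c (transition x c y)).comp (fderiv ℝ (transition x c) y) := by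
    have h1 := e.mfderiv_eq (I := 𝓡 n) (I' := 𝓡 n)
    rw [mfderiv_comp y (mdifferentiableAt_extChartAt_symm hτ)
      ((contDiffAt_transition hy hc).differentiableAt (by simp)).mdifferentiableAt,
      mfderiv_eq_fderiv] at h1
    exact h1
  let f : EuclideanSpace ℝ (Fin n) →ₗ[ℝ] EuclideanSpace ℝ (Fin n) →ₗ[ℝ] ℝ :=
    (modelForm h ((extChartAt (𝓡 n) x).symm y)).compl₁₂
      (chartInvDeriv c (transition x c y)).toLinearMap
      (chartInvDeriv c (transition x c y)).toLinearMap
  have := bilinear_comp_matrix f (fderiv ℝ (transition x c) y)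
  rw [coordMatrix_eq, coordMatrix_eq, hinv hc, hd]
  exact this

/-- The scalar curvature can be computed in any preferred chart. -/
lemma scalarCurvature_eq (g : C2Metric n M) {c x : M} (hx : x ∈ (extChartAt (𝓡 n) c).source) :
    scalarCurvature g x = localScalarCurvature (coordMatrix g.inner c) (extChartAt (𝓡 n) c x) := by
  have hxx : x ∈ (extChartAt (𝓡 n) x).source := mem_extChartAt_source x
  have hz := (extChartAt (𝓡 n) x).map_source hxx
  have hev := eventually_mem_overlap hxx hx
  rw [scalarCurvature, ← transition_extChartAt (c := c) hxx]
  refine localScalarCurvature_transform ?_ (isC2MetricAt_coordMatrix g hz)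
    ((contDiffAt_transition hz hev.self_of_nhds.2).of_le (by norm_cast)) ?_
  · rw [transition_extChartAt hxx]
    exact isC2MetricAt_coordMatrix g ((extChartAt (𝓡 n) c).map_source hx)
  · filter_upwards [hev.eventually_nhds] with y hy
    exact coordMatrix_transition g.inner hy

/-- The definition changes chart with the point; near `x` all values can be computed in the single
chart at `x`. -/
lemma continuous_scalarCurvature (g : C2Metric n M) : Continuous (scalarCurvature g) := by
  rw [continuous_iff_continuousAt]
  intro x
  have hxx : x ∈ (extChartAt (𝓡 n) x).source := mem_extChartAt_source x
  have hz := (extChartAt (𝓡 n) x).map_source hxx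
  have h1 := ContinuousAt.comp (isC2MetricAt_coordMatrix g hz).continuousAt_localScalarCurvature
    (continuousAt_extChartAt (I := 𝓡 n) x)
  refine h1.congr ?_
  filter_upwards [(isOpen_extChartAt_source (I := 𝓡 n) x).mem_nhds hxx] with y hy
  exact (scalarCurvature_eq g hy).symm

/-- The squared norm of the differential of a function, at a point of the manifold. -/
lemma localGradSq_eq (g : C2Metric n M) {u : M → ℝ} {c x : M}
    (hu : DifferentiableAt ℝ (u ∘ (extChartAt (𝓡 n) c).symm) (extChartAt (𝓡 n) c x))
    (hx : x ∈ (extChartAt (𝓡 n) c).source) :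
    localGradSq (coordMatrix g.inner x) (u ∘ (extChartAt (𝓡 n) x).symm) (extChartAt (𝓡 n) x x)
      = localGradSq (coordMatrix g.inner c) (u ∘ (extChartAt (𝓡 n) c).symm)
        (extChartAt (𝓡 n) c x) := by
  have hxx : x ∈ (extChartAt (𝓡 n) x).source := mem_extChartAt_source x
  have hz := (extChartAt (𝓡 n) x).map_source hxx
  have hev := eventually_mem_overlap hxx hx
  have hpull := coordMatrix_transition g.inner hev
  have hP : (stdMatrix (fderiv ℝ (transition x c) (extChartAt (𝓡 n) x x))).det ≠ 0 := by
    intro h0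
    have := (posDef_coordMatrix g hz).det_pos.ne'
    rw [hpull, Matrix.det_mul, h0, mul_zero] at this
    exact this rfl
  have e : u ∘ (extChartAt (𝓡 n) x).symm =ᶠ[𝓝 (extChartAt (𝓡 n) x x)]
      (u ∘ (extChartAt (𝓡 n) c).symm) ∘ transition x c := by
    filter_upwards [hev] with y hy
    simp only [Function.comp_apply, transition, (extChartAt (𝓡 n) c).left_inv hy.2]
  have e2 : localGradSq (coordMatrix g.inner x) (u ∘ (extChartAt (𝓡 n) x).symm)
      (extChartAt (𝓡 n) x x) = localGradSq (coordMatrix g.inner x)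
      ((u ∘ (extChartAt (𝓡 n) c).symm) ∘ transition x c) (extChartAt (𝓡 n) x x) := by
    simp only [localGradSq, partialDeriv, e.fderiv_eq]
  rw [← transition_extChartAt (c := c) hxx] at hu ⊢
  rw [e2]
  exact localGradSq_transform hP
    ((contDiffAt_transition hz hev.self_of_nhds.2).differentiableAt (by simp)) hu hpull

end Charts

end TotalScalar

namespace TotalScalar

section Integration

variable {n : ℕ} {M : Type*} [TopologicalSpace M] [ChartedSpace (EuclideanSpace ℝ (Fin n)) M]

/-! ### Integration in the preferred charts -/

lemma aemeasurable_extChartAt_symm [MeasurableSpace M] [BorelSpace M] (c : M)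
    (f : EuclideanSpace ℝ (Fin n) → ℝ≥0∞) :
    AEMeasurable (extChartAt (𝓡 n) c).symm
      (((volume : Measure (EuclideanSpace ℝ (Fin n))).restrict
        (extChartAt (𝓡 n) c).target).withDensity f) :=
  ((continuousOn_extChartAt_symm c).aemeasurable
    (isOpen_extChartAt_target c).measurableSet).mono_ac (withDensity_absolutelyContinuous _ _)

variable [IsManifold (𝓡 n) ∞ M]

lemma continuousOn_sqrt_det (g : C2Metric n M) (c : M) :
    ContinuousOn (fun z => Real.sqrt (coordMatrix g.inner c z).det)
      (extChartAt (𝓡 n) c).target := fun _ hz =>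
  (contDiffAt_det (contDiffAt_coordMatrix g hz)).continuousAt.sqrt.continuousWithinAt

lemma aemeasurable_density (g : C2Metric n M) (c : M) :
    AEMeasurable (fun z => ENNReal.ofReal (Real.sqrt (coordMatrix g.inner c z).det))
      ((volume : Measure (EuclideanSpace ℝ (Fin n))).restrict (extChartAt (𝓡 n) c).target) :=
  ((continuousOn_sqrt_det g c).aemeasurable
    (isOpen_extChartAt_target c).measurableSet).ennreal_ofReal

variable [CompactSpace M] [T2Space M]

/-- The functions of the partition of unity, in coordinates, extended by zero. -/
def chartCutoff (c : M) : EuclideanSpace ℝ (Fin n) → ℝ :=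
  (extChartAt (𝓡 n) c).target.indicator
    fun z => chartPartition n M c ((extChartAt (𝓡 n) c).symm z)

lemma tsupport_chartPartition (c : M) :
    tsupport (chartPartition n M c) ⊆ (extChartAt (𝓡 n) c).source := by
  rw [extChartAt_source]
  exact Classical.choose_spec (SmoothPartitionOfUnity.exists_isSubordinate_chartAt_source (𝓡 n) M) c

lemma chartCutoff_of_mem {c : M} {z : EuclideanSpace ℝ (Fin n)}
    (hz : z ∈ (extChartAt (𝓡 n) c).target) :
    chartCutoff c z = chartPartition n M c ((extChartAt (𝓡 n) c).symm z) :=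
  Set.indicator_of_mem hz _

lemma mem_target_of_chartCutoff_pos {c : M} {z : EuclideanSpace ℝ (Fin n)}
    (hz : 0 < chartCutoff c z) : z ∈ (extChartAt (𝓡 n) c).target := by
  by_contra h
  rw [chartCutoff, Set.indicator_of_notMem h] at hz
  exact lt_irrefl _ hz

lemma chartCutoff_nonneg (c : M) (z : EuclideanSpace ℝ (Fin n)) : 0 ≤ chartCutoff c z :=
  Set.indicator_nonneg (fun _ _ => (chartPartition n M).nonneg c _) z

/-- `K` is the image of the closed support of the partition function: compact since `M` is, and
inside the chart by subordination. Thus the extension by zero stays regular at the edge of the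
chart. -/
lemma exists_compact_chartCutoff (c : M) : ∃ K : Set (EuclideanSpace ℝ (Fin n)), IsCompact K ∧
    K ⊆ (extChartAt (𝓡 n) c).target ∧ ∀ z ∉ K, chartCutoff c z = 0 := by
  have hs := tsupport_chartPartition (n := n) c
  refine ⟨extChartAt (𝓡 n) c '' tsupport (chartPartition n M c), ?_, ?_, ?_⟩
  · exact (isClosed_tsupport _).isCompact.image_of_continuousOn
      ((continuousOn_extChartAt c).mono hs)
  · rintro _ ⟨x, hx, rfl⟩
    exact (extChartAt (𝓡 n) c).map_source (hs hx)
  · intro z hz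
    by_cases hzt : z ∈ (extChartAt (𝓡 n) c).target
    · rw [chartCutoff_of_mem hzt]
      by_contra h
      exact hz ⟨_, subset_tsupport _ h, (extChartAt (𝓡 n) c).right_inv hzt⟩
    · exact Set.indicator_of_notMem hzt _

lemma hasCompactSupport_chartCutoff (c : M) : HasCompactSupport (chartCutoff (n := n) c) := by
  obtain ⟨K, hK, -, h0⟩ := exists_compact_chartCutoff (n := n) c
  exact HasCompactSupport.intro hK h0

lemma tsupport_chartCutoff (c : M) :
    tsupport (chartCutoff (n := n) c) ⊆ (extChartAt (𝓡 n) c).target := by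
  obtain ⟨K, hK, hKt, h0⟩ := exists_compact_chartCutoff (n := n) c
  refine (closure_minimal (fun z hz => ?_) hK.isClosed).trans hKt
  by_contra h
  exact hz (h0 z h)

lemma contDiff_chartCutoff (c : M) : ContDiff ℝ 1 (chartCutoff (n := n) c) := by
  rw [contDiff_iff_contDiffAt]
  intro z
  by_cases hz : z ∈ tsupport (chartCutoff (n := n) c)
  · have hzt := tsupport_chartCutoff c hz
    have h1 : ContMDiffAt (𝓡 n) 𝓘(ℝ, ℝ) ∞
        (chartPartition n M c ∘ (extChartAt (𝓡 n) c).symm) z :=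
      (chartPartition n M c).contMDiff.contMDiffAt.comp z (contMDiffAt_extChartAt_symm hzt)
    refine (h1.contDiffAt.of_le (by norm_cast)).congr_of_eventuallyEq ?_
    filter_upwards [(isOpen_extChartAt_target (I := 𝓡 n) c).mem_nhds hzt] with y hy
    exact chartCutoff_of_mem hy
  · exact contDiffAt_const.congr_of_eventuallyEq (notMem_tsupport_iff_eventuallyEq.1 hz)

variable [MeasurableSpace M] [BorelSpace M]

lemma measurable_chartPartition (c : M) :
    Measurable fun x => ENNReal.ofReal (chartPartition n M c x) :=
  (chartPartition n M c).contMDiff.continuous.measurable.ennreal_ofReal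

/-- A property that holds almost everywhere on the manifold holds almost everywhere in a chart,
where the function of the partition of unity is positive. -/
lemma ae_chart_of_ae (g : C2Metric n M) {P : M → Prop} (hP : ∀ᵐ x ∂volumeMeasure g, P x)
    (c : M) : ∀ᵐ z : EuclideanSpace ℝ (Fin n),
      0 < chartCutoff c z → P ((extChartAt (𝓡 n) c).symm z) := by
  have h1 : ∀ᵐ x ∂(chartVolume g c).withDensity
      fun x => ENNReal.ofReal (chartPartition n M c x), P x :=
    (Measure.absolutelyContinuous_of_le (Measure.le_sum _ c)).ae_le hP
  rw [ae_withDensity_iff (measurable_chartPartition c)] at h1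
  have h2 := ae_of_ae_map (aemeasurable_extChartAt_symm c _) h1
  rw [ae_withDensity_iff' (aemeasurable_density g c),
    ae_restrict_iff' (isOpen_extChartAt_target c).measurableSet] at h2
  filter_upwards [h2] with z hz hpos
  have hzt := mem_target_of_chartCutoff_pos hpos
  -- Both densities are positive at such points, so null sets of the volume measure pull back to
  -- Lebesgue null sets there.
  refine hz hzt ?_ ?_
  · simpa using (posDef_coordMatrix g hzt).det_pos
  · rw [chartCutoff_of_mem hzt] at hpos
    simpa using hpos

/-- Integration of a continuous function against a piece of the volume measure. -/
lemma integral_chart (g : C2Metric n M) (c : M) {F : M → ℝ} (hF : Continuous F) :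
    Integrable F ((chartVolume g c).withDensity
      fun x => ENNReal.ofReal (chartPartition n M c x)) ∧
    ∫ x, F x ∂((chartVolume g c).withDensity fun x => ENNReal.ofReal (chartPartition n M c x))
      = ∫ z, chartCutoff c z * (F ((extChartAt (𝓡 n) c).symm z)
        * Real.sqrt (coordMatrix g.inner c z).det) := by
  have hopen := isOpen_extChartAt_target (I := 𝓡 n) c
  have hρF : Continuous fun x => chartPartition n M c x * F x :=
    (chartPartition n M c).contMDiff.continuous.mul hF
  have e (x : M) : (ENNReal.ofReal (chartPartition n M c x)).toReal • F x
      = chartPartition n M c x * F x := by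
    rw [ENNReal.toReal_ofReal ((chartPartition n M).nonneg c x), smul_eq_mul]
  have e2 (z : EuclideanSpace ℝ (Fin n)) :
      (extChartAt (𝓡 n) c).target.indicator (fun z =>
        (ENNReal.ofReal (Real.sqrt (coordMatrix g.inner c z).det)).toReal •
        (chartPartition n M c ((extChartAt (𝓡 n) c).symm z)
          * F ((extChartAt (𝓡 n) c).symm z))) z
      = chartCutoff c z * (F ((extChartAt (𝓡 n) c).symm z)
        * Real.sqrt (coordMatrix g.inner c z).det) := by
    by_cases hz : z ∈ (extChartAt (𝓡 n) c).target
    · rw [Set.indicator_of_mem hz, chartCutoff_of_mem hz,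
        ENNReal.toReal_ofReal (Real.sqrt_nonneg _), smul_eq_mul]
      ring
    · rw [Set.indicator_of_notMem hz, chartCutoff, Set.indicator_of_notMem hz, zero_mul]
  constructor
  · rw [integrable_withDensity_iff_integrable_smul' (measurable_chartPartition c)
      (.of_forall fun _ => ENNReal.ofReal_lt_top)]
    simp only [e]
    rw [chartVolume, integrable_map_measure hρF.aestronglyMeasurable
      (aemeasurable_extChartAt_symm c _), integrable_withDensity_iff_integrable_smul₀'
      (aemeasurable_density g c) (.of_forall fun _ => ENNReal.ofReal_lt_top)]
    change IntegrableOn _ _ _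
    rw [← integrable_indicator_iff hopen.measurableSet]
    refine integrable_of_eq_zero_off_tsupport (hasCompactSupport_chartCutoff c)
      (fun z hz => ?_) fun z hz => ?_
    · have hzt := tsupport_chartCutoff c hz
      refine ContinuousAt.congr ?_ (.of_forall fun y => (e2 y).symm)
      refine (contDiff_chartCutoff c).continuous.continuousAt.mul
        (ContinuousAt.mul ?_ ((continuousOn_sqrt_det g c).continuousAt (hopen.mem_nhds hzt)))
      exact hF.continuousAt.comp (contMDiffAt_extChartAt_symm hzt).continuousAt
    · refine (e2 z).trans ?_
      rw [image_eq_zero_of_notMem_tsupport hz, zero_mul]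
  · rw [integral_withDensity_eq_integral_toReal_smul (measurable_chartPartition c)
      (.of_forall fun _ => ENNReal.ofReal_lt_top)]
    simp only [e]
    rw [chartVolume, integral_map (aemeasurable_extChartAt_symm c _) hρF.aestronglyMeasurable,
      integral_withDensity_eq_integral_toReal_smul₀ (aemeasurable_density g c)
        (.of_forall fun _ => ENNReal.ofReal_lt_top), ← integral_indicator hopen.measurableSet]
    exact integral_congr_ae (.of_forall e2)

/-- The total scalar curvature, computed in the preferred charts. -/
lemma exists_totalScalarCurvature_eq_sum : ∃ s : Finset M, ∀ g : C2Metric n M,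
    totalScalarCurvature g = ∑ c ∈ s, ∫ z, chartCutoff c z *
      (localScalarCurvature (coordMatrix g.inner c) z
        * Real.sqrt (coordMatrix g.inner c z).det) := by
  -- By local finiteness and compactness only finitely many partition functions are nonzero, and
  -- this index set does not depend on the metric.
  have hfin := (chartPartition n M).locallyFinite.finite_nonempty_of_compact
  refine ⟨hfin.toFinset, fun g => ?_⟩
  have h0 : ∀ c ∉ hfin.toFinset, ((chartVolume g c).withDensity
      fun x => ENNReal.ofReal (chartPartition n M c x)) = 0 := by
    intro c hc
    have : ∀ x, chartPartition n M c x = 0 := by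
      intro x
      by_contra hx
      exact hc (hfin.mem_toFinset.2 ⟨x, hx⟩)
    simp only [this, ENNReal.ofReal_zero]
    exact withDensity_zero
  have hvol : volumeMeasure g = ∑ c ∈ hfin.toFinset, ((chartVolume g c).withDensity
      fun x => ENNReal.ofReal (chartPartition n M c x)) := by
    ext A hA
    rw [volumeMeasure, Measure.sum_apply _ hA, Measure.finsetSum_apply]
    exact tsum_eq_sum fun c hc => by rw [h0 c hc]; rfl
  have hcont := continuous_scalarCurvature g
  rw [totalScalarCurvature, hvol,
    integral_finsetSum_measure fun c _ => (integral_chart g c hcont).1]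
  refine Finset.sum_congr rfl fun c _ => ?_
  rw [(integral_chart g c hcont).2]
  congr 1
  ext z
  by_cases hz : z ∈ (extChartAt (𝓡 n) c).target
  · rw [scalarCurvature_eq g ((extChartAt (𝓡 n) c).map_target hz),
      (extChartAt (𝓡 n) c).right_inv hz]
  · rw [chartCutoff, Set.indicator_of_notMem hz, zero_mul, zero_mul]

end Integration

section Convergence

variable {n : ℕ} {M : Type*} [TopologicalSpace M] [ChartedSpace (EuclideanSpace ℝ (Fin n)) M]
  [IsManifold (𝓡 n) ∞ M]

/-! ### Conformal convergence in the `W^{1,∞}`-sense -/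

lemma contDiffAt_comp_extChartAt_symm {u : M → ℝ} (hu : ContMDiff (𝓡 n) 𝓘(ℝ, ℝ) 2 u) {c : M}
    {z : EuclideanSpace ℝ (Fin n)} (hz : z ∈ (extChartAt (𝓡 n) c).target) :
    ContDiffAt ℝ 2 (u ∘ (extChartAt (𝓡 n) c).symm) z :=
  (hu.contMDiffAt.comp z ((contMDiffAt_extChartAt_symm hz).of_le (by norm_cast))).contDiffAt

/-- The right side equals `√n |u - 1|`, and `n ≥ 1`. -/
lemma abs_sub_one_le_tensorNorm (hn : 1 ≤ n) (g g' : C2Metric n M) {u : M → ℝ}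
    (hconf : ∀ x, g'.inner x = u x • g.inner x) (x : M) :
    |u x - 1| ≤ tensorNorm g (fun x => g'.inner x - g.inner x) x := by
  have hxx : x ∈ (extChartAt (𝓡 n) x).source := mem_extChartAt_source x
  have hz := (extChartAt (𝓡 n) x).map_source hxx
  rw [tensorNorm, coordMatrix_smul_sub u hconf, localTensorNormSq_conformal
    (u := fun z => u ((extChartAt (𝓡 n) x).symm z)) (isC2MetricAt_coordMatrix g hz),
    (extChartAt (𝓡 n) x).left_inv hxx]
  apply Real.abs_le_sqrt
  have : (1 : ℝ) ≤ n := by exact_mod_cast hn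
  nlinarith [sq_nonneg (u x - 1)]

/-- The norm satisfies `|∇((u - 1) g)|² = n |du|²` in the chart at the point itself. Invariance of
`|du|²` carries this to the chart at `c`, where Cauchy-Schwarz applies. -/
lemma sq_partialDeriv_le_covDerivNorm (hn : 1 ≤ n) (g g' : C2Metric n M) {u : M → ℝ}
    (hu : ContMDiff (𝓡 n) 𝓘(ℝ, ℝ) 2 u) (hconf : ∀ x, g'.inner x = u x • g.inner x) (c : M)
    {z : EuclideanSpace ℝ (Fin n)} (hz : z ∈ (extChartAt (𝓡 n) c).target) (k : Fin n) :
    (partialDeriv k (u ∘ (extChartAt (𝓡 n) c).symm) z) ^ 2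
      ≤ (covDerivNorm g (fun x => g'.inner x - g.inner x) ((extChartAt (𝓡 n) c).symm z)) ^ 2
        * coordMatrix g.inner c z k k := by
  set x := (extChartAt (𝓡 n) c).symm z with hx
  have hxc : x ∈ (extChartAt (𝓡 n) c).source := (extChartAt (𝓡 n) c).map_target hz
  have hxx : x ∈ (extChartAt (𝓡 n) x).source := mem_extChartAt_source x
  have hzx := (extChartAt (𝓡 n) x).map_source hxx
  have hcz : extChartAt (𝓡 n) c x = z := (extChartAt (𝓡 n) c).right_inv hz
  have hG := isC2MetricAt_coordMatrix g hz
  have hpos := posDef_coordMatrix g hz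
  have hcd := contDiffAt_comp_extChartAt_symm hu hz
  have hcx := contDiffAt_comp_extChartAt_symm hu hzx
  have hgrad := localGradSq_eq g (u := u) (c := c) (x := x)
    (by rw [hcz]; exact hcd.differentiableAt (by norm_num)) hxc
  rw [hcz] at hgrad
  have hn' : (1 : ℝ) ≤ n := by exact_mod_cast hn
  have h0 := localGradSq_nonneg hG hpos (u ∘ (extChartAt (𝓡 n) c).symm)
  have hnorm : (covDerivNorm g (fun x => g'.inner x - g.inner x) x) ^ 2
      = n * localGradSq (coordMatrix g.inner c) (u ∘ (extChartAt (𝓡 n) c).symm) z := by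
    rw [covDerivNorm, coordMatrix_smul_sub u hconf]
    have := localCovDerivNormSq_conformal (u := u ∘ (extChartAt (𝓡 n) x).symm)
      (isC2MetricAt_coordMatrix g hzx) (hcx.differentiableAt (by norm_num))
    simp only [Function.comp_apply] at this
    rw [this, Real.sq_sqrt]
    · exact congrArg _ hgrad
    · exact mul_nonneg (by linarith) (hgrad ▸ h0)
  rw [hnorm]
  refine (sq_partialDeriv_le hG hpos _ k).trans (mul_le_mul_of_nonneg_right ?_ ?_)
  · nlinarith
  · have := posDef_matrixBilin hpos (stdE k)
    rwa [matrixBilin_stdE] at this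

variable [CompactSpace M] [T2Space M] [MeasurableSpace M]

/-- Almost everywhere, the pointwise norms are bounded by the `W^{1,∞}`-norm. -/
lemma ae_le_sobolevNorm (g : C2Metric n M) (h : BilinField n M) (hfin : sobolevNorm ∞ g h ≠ ⊤) :
    ∀ᵐ x ∂volumeMeasure g, tensorNorm g h x ≤ (sobolevNorm ∞ g h).toReal
      ∧ covDerivNorm g h x ≤ (sobolevNorm ∞ g h).toReal := by
  have key {f : M → ℝ} (hf : eLpNorm f ∞ (volumeMeasure g) ≤ sobolevNorm ∞ g h) :
      ∀ᵐ x ∂volumeMeasure g, f x ≤ (sobolevNorm ∞ g h).toReal := by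
    rw [eLpNorm_exponent_top] at hf
    filter_upwards [ae_le_eLpNormEssSup (f := f) (μ := volumeMeasure g)] with x hx
    refine (le_abs_self _).trans ?_
    rw [← Real.norm_eq_abs, ← toReal_enorm]
    exact ENNReal.toReal_mono hfin (hx.trans hf)
  exact (key le_self_add).and (key le_add_self)

end Convergence

end TotalScalar

namespace TotalScalar

/-! ### Uniform bounds in a chart and passage to the limit. -/

section Convergence

variable {n : ℕ} {M : Type*} [TopologicalSpace M] [ChartedSpace (EuclideanSpace ℝ (Fin n)) M]
  [IsManifold (𝓡 n) ∞ M] [CompactSpace M] [T2Space M] [MeasurableSpace M]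
  [BorelSpace M]

lemma partialDeriv_log {v : EuclideanSpace ℝ (Fin n) → ℝ} {z : EuclideanSpace ℝ (Fin n)}
    (hv : DifferentiableAt ℝ v z) (h0 : v z ≠ 0) (k : Fin n) :
    partialDeriv k (fun w => Real.log (v w)) z = partialDeriv k v z / v z := by
  rw [partialDeriv, fderiv.log hv h0, smul_apply, smul_eq_mul, partialDeriv]
  ring

lemma abs_log_le_one {t : ℝ} (ht : |t - 1| ≤ 1 / 2) : |Real.log t| ≤ 1 := by
  obtain ⟨h1, h2⟩ := abs_le.1 ht
  have h0 : 0 < t := by linarith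
  rw [abs_le]
  constructor
  · have := Real.one_sub_inv_le_log_of_pos h0
    have h3 : t⁻¹ ≤ 2 := by
      rw [inv_le_comm₀ h0 two_pos]
      linarith
    linarith
  · linarith [Real.log_le_sub_one_of_pos h0]

variable {g : C2Metric n M} {gs : ℕ → C2Metric n M} {u : ℕ → M → ℝ}

/-- In a chart, `W^{1,∞}`-convergence of conformal metrics yields a uniform bound, almost everywhere
on the support of the cutoff function, for the conformal factors and their differentials. -/
lemma exists_chart_bound (hn : 1 ≤ n) (hconv : SobolevConverges ∞ gs g)
    (hu : ∀ i, ContMDiff (𝓡 n) 𝓘(ℝ, ℝ) 2 (u i))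
    (hconf : ∀ i x, (gs i).inner x = u i x • g.inner x) (c : M) :
    ∃ ε : ℕ → ℝ, Tendsto ε atTop (𝓝 0) ∧ ∀ᶠ i in atTop, ∀ᵐ z : EuclideanSpace ℝ (Fin n),
      0 < chartCutoff c z → |u i ((extChartAt (𝓡 n) c).symm z) - 1| ≤ ε i ∧
        ∀ k, |partialDeriv k (u i ∘ (extChartAt (𝓡 n) c).symm) z| ≤ ε i := by
  set N : ℕ → ℝ≥0∞ := fun i => sobolevNorm ∞ g (fun x => (gs i).inner x - g.inner x) with hN
  have hN0 : Tendsto N atTop (𝓝 0) := hconv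
  have hδ : Tendsto (fun i => (N i).toReal) atTop (𝓝 0) := by
    simpa [Function.comp_def] using (ENNReal.tendsto_toReal ENNReal.zero_ne_top).comp hN0
  have hK : IsCompact (tsupport (chartCutoff (n := n) c)) := hasCompactSupport_chartCutoff c
  have hB (k : Fin n) : ∃ B : ℝ, ∀ z ∈ tsupport (chartCutoff (n := n) c),
      ‖coordMatrix g.inner c z k k‖ ≤ B :=
    hK.exists_bound_of_continuousOn fun z hz =>
      (contDiffAt_coordMatrix g (tsupport_chartCutoff c hz) k k).continuousAt.continuousWithinAt
  choose B hB using hB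
  -- `C` dominates both `1` and every `B k`, so `g_kk ≤ C ≤ C²` on the support; one factor `C` then
  -- serves for the functions and for their derivatives.
  set C : ℝ := 1 + ∑ k, |B k| with hC
  have hC1 : 1 ≤ C := le_add_of_nonneg_right (Finset.sum_nonneg fun k _ => abs_nonneg _)
  have hBC (k : Fin n) : B k ≤ C := by
    have := Finset.single_le_sum (f := fun k => |B k|) (fun k _ => abs_nonneg _)
      (Finset.mem_univ k)
    linarith [le_abs_self (B k)]
  refine ⟨fun i => (N i).toReal * C, by simpa using hδ.mul_const C, ?_⟩
  -- Finiteness is needed because `toReal` sends `⊤` to `0`; it holds eventually.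
  filter_upwards [hN0.eventually_ne ENNReal.top_ne_zero.symm] with i hi
  filter_upwards [ae_chart_of_ae g (ae_le_sobolevNorm g _ hi) c] with z hz hpos
  obtain ⟨h1, h2⟩ := hz hpos
  have hzt := mem_target_of_chartCutoff_pos hpos
  have hδ0 : 0 ≤ (N i).toReal := ENNReal.toReal_nonneg
  constructor
  · refine (abs_sub_one_le_tensorNorm hn g (gs i) (hconf i) _).trans (h1.trans ?_)
    exact le_mul_of_one_le_right hδ0 hC1
  · intro k
    refine abs_le_of_sq_le_sq ?_ (by positivity)
    refine (sq_partialDeriv_le_covDerivNorm hn g (gs i) (hu i) (hconf i) c hzt k).trans ?_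
    rw [mul_pow]
    have h3 : coordMatrix g.inner c z k k ≤ C ^ 2 := by
      have := hB k z (subset_tsupport _ hpos.ne')
      nlinarith [le_abs_self (coordMatrix g.inner c z k k), Real.norm_eq_abs
        (coordMatrix g.inner c z k k), hBC k]
    have h4 : 0 ≤ covDerivNorm g (fun x => (gs i).inner x - g.inner x)
      ((extChartAt (𝓡 n) c).symm z) := Real.sqrt_nonneg _
    have h5 : 0 ≤ coordMatrix g.inner c z k k := by
      have := posDef_matrixBilin (posDef_coordMatrix g hzt) (stdE k)
      rwa [matrixBilin_stdE] at this
    gcongr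

/-- The total scalar curvature is continuous along conformal sequences converging in the
`W^{1,∞}`-sense. -/
theorem tendsto_totalScalarCurvature (hn : 1 ≤ n) (hconv : SobolevConverges ∞ gs g)
    (hu : ∀ i, ContMDiff (𝓡 n) 𝓘(ℝ, ℝ) 2 (u i)) (hu_pos : ∀ i x, 0 < u i x)
    (hconf : ∀ i x, (gs i).inner x = u i x • g.inner x) :
    Tendsto (fun i => totalScalarCurvature (gs i)) atTop (𝓝 (totalScalarCurvature g)) := by
  obtain ⟨s, hs⟩ := exists_totalScalarCurvature_eq_sum (n := n) (M := M)
  simp only [hs]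
  refine tendsto_finsetSum _ fun c _ => ?_
  obtain ⟨ε, hε, hbound⟩ := exists_chart_bound hn hconv hu hconf c
  set φ : ℕ → EuclideanSpace ℝ (Fin n) → ℝ :=
    fun i z => Real.log (u i ((extChartAt (𝓡 n) c).symm z)) with hφ
  have hG (i : ℕ) : coordMatrix (gs i).inner c
      = fun z => Real.exp (φ i z) • coordMatrix g.inner c z := by
    rw [coordMatrix_smul (u i) (hconf i)]
    simp only [hφ, Real.exp_log (hu_pos i _)]
  have hsub := tsupport_chartCutoff (n := n) c
  have hcd (i : ℕ) {z : EuclideanSpace ℝ (Fin n)} (hz : z ∈ (extChartAt (𝓡 n) c).target) :=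
    contDiffAt_comp_extChartAt_symm (hu i) hz
  have hdφ (i : ℕ) {z : EuclideanSpace ℝ (Fin n)} (hz : z ∈ (extChartAt (𝓡 n) c).target)
      (k : Fin n) : partialDeriv k (φ i) z
        = partialDeriv k (u i ∘ (extChartAt (𝓡 n) c).symm) z
          / u i ((extChartAt (𝓡 n) c).symm z) :=
    partialDeriv_log ((hcd i hz).differentiableAt (by norm_num)) (hu_pos i _).ne' k
  simp only [hG]
  refine tendsto_integral_scalarCurvature_conformal (contDiff_chartCutoff c)
    (hasCompactSupport_chartCutoff c) (chartCutoff_nonneg c)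
    (fun z hz => isC2MetricAt_coordMatrix g (hsub hz))
    (fun z hz => (posDef_coordMatrix g (hsub hz)).det_pos)
    (fun i z hz => (hcd i (hsub hz)).log (hu_pos i _).ne') ?_ ?_
  · obtain ⟨i₀, hi₀⟩ := eventually_atTop.1 hbound
    -- The exceptional null sets depend on `i`; since there are countably many, the quantifiers can
    -- be exchanged.
    have : ∀ᵐ z : EuclideanSpace ℝ (Fin n), ∀ i, i₀ ≤ i → 0 < chartCutoff c z →
        |u i ((extChartAt (𝓡 n) c).symm z) - 1| ≤ ε i ∧
        ∀ k, |partialDeriv k (u i ∘ (extChartAt (𝓡 n) c).symm) z| ≤ ε i := by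
      rw [ae_all_iff]
      intro i
      by_cases hi : i₀ ≤ i
      · filter_upwards [hi₀ i hi] with z hz _ using hz
      · exact .of_forall fun z h => absurd h hi
    filter_upwards [this] with z hz hpos
    have hzt := mem_target_of_chartCutoff_pos hpos
    have hut : Tendsto (fun i => u i ((extChartAt (𝓡 n) c).symm z)) atTop (𝓝 1) := by
      rw [tendsto_iff_norm_sub_tendsto_zero]
      refine squeeze_zero' (.of_forall fun i => norm_nonneg _) ?_ hε
      filter_upwards [eventually_ge_atTop i₀] with i hi using (hz i hi hpos).1
    constructor
    · have := hut.log one_ne_zero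
      rwa [Real.log_one] at this
    · intro k
      simp only [fun i => hdφ i hzt k]
      have : Tendsto (fun i => partialDeriv k (u i ∘ (extChartAt (𝓡 n) c).symm) z) atTop
          (𝓝 0) := by
        rw [tendsto_zero_iff_norm_tendsto_zero]
        refine squeeze_zero' (.of_forall fun i => norm_nonneg _) ?_ hε
        filter_upwards [eventually_ge_atTop i₀] with i hi using (hz i hi hpos).2 k
      have := this.div hut one_ne_zero
      rwa [zero_div] at this
  -- Once `ε i ≤ 1/2`, one has `u ≥ 1/2 ≥ |∂_k u|`, so both `|log u|` and `|∂_k log u|` are at most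
  -- `1`.
  · filter_upwards [hbound, hε.eventually_le_const (show (0 : ℝ) < 1 / 2 by norm_num)]
      with i hi hεi
    filter_upwards [hi] with z hz hpos
    obtain ⟨h1, h2⟩ := hz hpos
    refine ⟨abs_log_le_one (h1.trans hεi), fun k => ?_⟩
    rw [hdφ i (mem_target_of_chartCutoff_pos hpos), abs_div, abs_of_pos (hu_pos i _),
      div_le_one (hu_pos i _)]
    have := (abs_le.1 (h1.trans hεi)).1
    linarith [h2 k]

end Convergence

end TotalScalar

end
theorem mainTheorem9 {n : ℕ} (hn : 3 ≤ n)
    {M : Type*} [TopologicalSpace M] [ChartedSpace (EuclideanSpace ℝ (Fin n)) M]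
    [IsManifold (𝓡 n) ∞ M] [CompactSpace M] [T2Space M] [MeasurableSpace M] [BorelSpace M]
    (g : TotalScalar.C2Metric n M) (gs : ℕ → TotalScalar.C2Metric n M)
    (hconv : TotalScalar.SobolevConverges ∞ gs g)
    (u : ℕ → M → ℝ)
    (hu : ∀ i, ContMDiff (𝓡 n) 𝓘(ℝ, ℝ) 2 (u i))
    (hu_pos : ∀ i x, 0 < u i x)
    (hconf : ∀ i x, (gs i).inner x = u i x • g.inner x)
    (κ : ℝ) (hκ : ∀ i, κ ≤ TotalScalar.totalScalarCurvature (gs i)) :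
    κ ≤ TotalScalar.totalScalarCurvature g :=
  ge_of_tendsto' (TotalScalar.tendsto_totalScalarCurvature (by omega) hconv hu hu_pos hconf) hκ
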